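/- Let $n,n_1$ be dimensions, $T>0$, and let $A,G,\Gamma,\Gamma_f\in\mathbb R^{n\times n}$, $B,B_0,B_1\in\mathbb R^{n\times n_1}$ be constant matrices and $Q,Q_f\in\mathbb R^{n\times n}$, $R\in\mathbb R^{n_1\times n_1}$ symmetric, possibly indefinite, matrices. Consider the $N$-player linear-quadratic Nash game in which player $i$, $1\le i\le N$, has the dynamics $$dX_i=(AX_i+Bu_i+GX^{(N)})\,dt+B_1u_i\,dW_i+B_0u^{(N)}\,dW_0,\qquad X^{(N)}=\tfrac1N\sum_{k=1}^N X_k,\quad u^{(N)}=\tfrac1N\sum_{k=1}^N u_k,$$ with independent standard Brownian motions $W_0,W_1,\dots,W_N$, and the cost (where $[x]_M^2=x^TMx$) $$J_i=\mathbb E\Big[\int_0^T\big([X_i-\Gamma X^{(N)}]_Q^2+[u_i]_R^2\big)dt+[X_i(T)-\Gamma_fX^{(N)}(T)]_{Q_f}^2\Big].$$ For each $N$ put $\mathbf A=\mathrm{diag}[A,\dots,A]+\mathbf 1_{N\times N}\otimes\frac GN$, $\mathbf B_0=\mathbf 1_{N\times1}\otimes\frac{B_0}N$, $\widehat{\mathbf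 B}_k=e_k^N\otimes B$, $\mathbf B_k=e_k^N\otimes B_1$, $\mathbf Q_i=\mathbf K_i^TQ\mathbf K_i$ and $\mathbf Q_{if}=\mathbf K_{if}^TQ_f\mathbf K_{if}$, where $\mathbf K_i=(e_i^N)^T\otimes I_n-\frac1N\mathbf 1_{1\times N}\otimes\Gamma$ and $\mathbf K_{if}=(e_i^N)^T\otimes I_n-\frac1N\mathbf 1_{1\times N}\otimes\Gamma_f$. For symmetric $\mathbf P_1,\dots,\mathbf P_N\in\mathbb R^{Nn\times Nn}$ write $$\mathbf R_k=R+\mathbf B_k^T\mathbf P_k\mathbf B_k,\quad \mathbf S_k=\mathbf B_0^T\mathbf P_k\mathbf B_0,\quad \mathbf I_0=I+\sum_{k=1}^N\mathbf R_k^{-1}\mathbf S_k,$$ $$\mathbf M_0=-\mathbf I_0^{-1}\sum_{k=1}^N\mathbf R_k^{-1}\widehat{\mathbf B}_k^T\mathbf P_k,\quad \mathbf U_k=\mathbf S_k\mathbf M_0+\widehat{\mathbf B}_k^T\mathbf P_k .$$ A solution on $[0,T]$ of the large Riccati system is a tuple of differentiable symmetric-matrix-valued functions $(\mathbf P_1,\dots,\mathbf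 P_N)$ on $[0,T]$ such that, for all $t\in[0,T]$ and $1\le i\le N$, $$\begin{aligned}-\dot{\mathbf P}_i={}&\mathbf P_i\mathbf A+\mathbf A^T\mathbf P_i+\mathbf Q_i-\mathbf P_i\widehat{\mathbf B}_i\mathbf R_i^{-1}\widehat{\mathbf B}_i^T\mathbf P_i+\mathbf M_0^T\mathbf S_i\mathbf R_i^{-1}\mathbf S_i\mathbf M_0-\mathbf P_i\sum_{k\ne i}\widehat{\mathbf B}_k\mathbf R_k^{-1}\mathbf U_k\\&-\sum_{k\ne i}\mathbf U_k^T\mathbf R_k^{-1}\widehat{\mathbf B}_k^T\mathbf P_i+\sum_{k\ne i}\mathbf U_k^T\mathbf R_k^{-1}\mathbf B_k^T\mathbf P_i\mathbf B_k\mathbf R_k^{-1}\mathbf U_k+\mathbf M_0^T\mathbf S_i\mathbf M_0,\end{aligned}$$ $\mathbf P_i(T)=\mathbf Q_{if}$, and for all $t\in[0,T]$ and all $i$: $\mathbf R_i>0$, $\mathbf R_i+\mathbf S_i>0$, and $\mathbf I_0$ is invertible. For $N\ge3$, let $\Pi_1^N,\Pi_2^N,\Pi_3^N,\Pi_4^N$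 be the $n\times n$ blocks of $\mathbf P_1$ in the positions $(1,1)$, $(1,2)$, $(2,2)$, $(2,3)$, and let $|\cdot|$ be the Euclidean (Frobenius) norm. The game is called asymptotically solvable if there exist $N_0\ge 3$ and $c_0>0$ such that for all $N\ge N_0$ the large Riccati system has a solution $(\mathbf P_1,\dots,\mathbf P_N)$ on $[0,T]$, and $$\sup_{N\ge N_0}\sup_{0\le t\le T}\big(|\Pi_1^N|+N|\Pi_2^N|+N^2|\Pi_3^N|+N^2|\Pi_4^N|\big)<\infty,$$ and for all $N\ge N_0$ and $t\in[0,T]$: $\mathbf R_i\ge c_0I$ for all $1\le i\le N$, and $\mathbf I_0$ is invertible. **Theorem.** The game is asymptotically solvable if and only if there exist differentiable functions $\Lambda_1,\Lambda_2:[0,T]\to\mathbb R^{n\times n}$, with $\Lambda_1(t)$ symmetric, such that, with $H=(R+B_1^T\Lambda_1B_1)^{-1}$, $$\begin{aligned}&\dot\Lambda_1=\Lambda_1BHB^T\Lambda_1-\Lambda_1A-A^T\Lambda_1-Q,\qquad \Lambda_1(T)=Q_f,\qquad R+B_1^T\Lambda_1(t)B_1>0\quad\forall t\in[0,T],\\ &\dot\Lambda_2=-\Lambda_1G-\Lambda_2(A+G)-A^T\Lambda_2+\Lambda_1BHB^T\Lambda_2+\Lambda_2BHB^T\Lambda_1+\Lambda_2BHB^T\Lambda_2+Q\Gamma,\qquad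 \Lambda_2(T)=-Q_f\Gamma_f\end{aligned}$$ on $[0,T]$. -/

import Mathlib

open Matrix Set

open scoped Matrix.Norms.Frobenius in
/-- The Euclidean norm `|F|` of a real matrix, i.e. the square root of the sum of the squares of
its entries. -/
noncomputable def euclNorm {a b : Type*} [Fintype a] [Fintype b] (F : Matrix a b ℝ) : ℝ := ‖F‖

/-- The constant coefficients of the LQ Nash game with states in `ℝⁿ`, controls in `ℝᵐ` and
horizon `[0, T]`: player `i` has the dynamics
`dXᵢ = (A Xᵢ + B uᵢ + G X⁽ᴺ⁾) dt + B₁ uᵢ dWᵢ + B₀ u⁽ᴺ⁾ dW₀`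
and the cost
`E ∫₀ᵀ ([Xᵢ - Γ X⁽ᴺ⁾]²_Q + [uᵢ]²_R) dt + E [Xᵢ(T) - Γf X⁽ᴺ⁾(T)]²_{Qf}`. -/
structure LQGame (n m : ℕ) where
  A : Matrix (Fin n) (Fin n) ℝ
  G : Matrix (Fin n) (Fin n) ℝ
  B : Matrix (Fin n) (Fin m) ℝ
  B₀ : Matrix (Fin n) (Fin m) ℝ
  B₁ : Matrix (Fin n) (Fin m) ℝ
  Γ : Matrix (Fin n) (Fin n) ℝ
  Γf : Matrix (Fin n) (Fin n) ℝ
  Q : Matrix (Fin n) (Fin n) ℝ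
  Qf : Matrix (Fin n) (Fin n) ℝ
  R : Matrix (Fin m) (Fin m) ℝ
  T : ℝ

namespace LQGame

variable {n m : ℕ} (g : LQGame n m)

section BigSystem

/- An `Nn × Nn` matrix is indexed by `Fin N × Fin n`; the pair `(j, a)` is the `a`-th coordinate
of the state of player `j`. -/
variable (N : ℕ)

/-- `𝐀 = diag[A, …, A] + 𝟏_{N×N} ⊗ (G/N)`. -/
noncomputable def bigA : Matrix (Fin N × Fin n) (Fin N × Fin n) ℝ :=
  Matrix.of fun p q => (if p.1 = q.1 then g.A p.2 q.2 else 0) + g.G p.2 q.2 / N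

/-- `𝐁₀ = 𝟏_{N×1} ⊗ (B₀/N)`. -/
noncomputable def bigB₀ : Matrix (Fin N × Fin n) (Fin m) ℝ :=
  Matrix.of fun p b => g.B₀ p.2 b / N

/-- `𝐁̂ₖ = eₖ ⊗ B`. -/
def bigBhat (k : Fin N) : Matrix (Fin N × Fin n) (Fin m) ℝ :=
  Matrix.of fun p b => if p.1 = k then g.B p.2 b else 0

/-- `𝐁ₖ = eₖ ⊗ B₁`. -/
def bigB (k : Fin N) : Matrix (Fin N × Fin n) (Fin m) ℝ :=
  Matrix.of fun p b => if p.1 = k then g.B₁ p.2 b else 0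

/-- `[0, …, 0, I, 0, …, 0] - (1/N) [Θ, …, Θ]`, with `I` in the `i`-th block. -/
noncomputable def bigK (Θ : Matrix (Fin n) (Fin n) ℝ) (i : Fin N) :
    Matrix (Fin n) (Fin N × Fin n) ℝ :=
  Matrix.of fun a q => (if q.1 = i then (1 : Matrix (Fin n) (Fin n) ℝ) a q.2 else 0) - Θ a q.2 / N

/-- `𝐐ᵢ = 𝐊ᵢᵀ Q 𝐊ᵢ`. -/
noncomputable def bigQ (i : Fin N) : Matrix (Fin N × Fin n) (Fin N × Fin n) ℝ :=
  (bigK N g.Γ i)ᵀ * g.Q * bigK N g.Γ i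

/-- `𝐐_{if} = 𝐊_{if}ᵀ Q_f 𝐊_{if}`. -/
noncomputable def bigQf (i : Fin N) : Matrix (Fin N × Fin n) (Fin N × Fin n) ℝ :=
  (bigK N g.Γf i)ᵀ * g.Qf * bigK N g.Γf i

variable {N} (P : Fin N → Matrix (Fin N × Fin n) (Fin N × Fin n) ℝ)

/-- `R + 𝐁ₖᵀ 𝐏ₖ 𝐁ₖ`. -/
def bigR (k : Fin N) : Matrix (Fin m) (Fin m) ℝ :=
  g.R + (g.bigB N k)ᵀ * P k * g.bigB N k

/-- `𝐁₀ᵀ 𝐏ₖ 𝐁₀`. -/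
noncomputable def bigS (k : Fin N) : Matrix (Fin m) (Fin m) ℝ :=
  (g.bigB₀ N)ᵀ * P k * g.bigB₀ N

/-- `I + ∑ₖ (R + 𝐁ₖᵀ 𝐏ₖ 𝐁ₖ)⁻¹ 𝐁₀ᵀ 𝐏ₖ 𝐁₀`. -/
noncomputable def bigI : Matrix (Fin m) (Fin m) ℝ :=
  1 + ∑ k, (g.bigR P k)⁻¹ * g.bigS P k

/-- `𝐌₀ = -[I + ∑ₖ (R + 𝐁ₖᵀ 𝐏ₖ 𝐁ₖ)⁻¹ 𝐁₀ᵀ 𝐏ₖ 𝐁₀]⁻¹ ∑ₖ (R + 𝐁ₖᵀ 𝐏ₖ 𝐁ₖ)⁻¹ 𝐁̂ₖᵀ 𝐏ₖ`. -/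
noncomputable def bigM₀ : Matrix (Fin m) (Fin N × Fin n) ℝ :=
  -((g.bigI P)⁻¹ * ∑ k, (g.bigR P k)⁻¹ * (g.bigBhat N k)ᵀ * P k)

/-- `𝐁₀ᵀ 𝐏ₖ 𝐁₀ 𝐌₀ + 𝐁̂ₖᵀ 𝐏ₖ`. -/
noncomputable def bigU (k : Fin N) : Matrix (Fin m) (Fin N × Fin n) ℝ :=
  g.bigS P k * g.bigM₀ P + (g.bigBhat N k)ᵀ * P k

/-- The right-hand side `Φᵢ(𝐏₁, …, 𝐏_N)` of the large Riccati equation `-𝐏̇ᵢ = Φᵢ`. -/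
noncomputable def bigPhi (i : Fin N) : Matrix (Fin N × Fin n) (Fin N × Fin n) ℝ :=
  P i * g.bigA N + (g.bigA N)ᵀ * P i + g.bigQ N i
    - P i * g.bigBhat N i * (g.bigR P i)⁻¹ * (g.bigBhat N i)ᵀ * P i
    + (g.bigM₀ P)ᵀ * g.bigS P i * (g.bigR P i)⁻¹ * g.bigS P i * g.bigM₀ P
    - P i * ∑ k ∈ Finset.univ.erase i, g.bigBhat N k * (g.bigR P k)⁻¹ * g.bigU P k
    - ∑ k ∈ Finset.univ.erase i, (g.bigU P k)ᵀ * (g.bigR P k)⁻¹ * (g.bigBhat N k)ᵀ * P i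
    + ∑ k ∈ Finset.univ.erase i, (g.bigU P k)ᵀ * (g.bigR P k)⁻¹ *
        ((g.bigB N k)ᵀ * P i * g.bigB N k) * (g.bigR P k)⁻¹ * g.bigU P k
    + (g.bigM₀ P)ᵀ * g.bigS P i * g.bigM₀ P

end BigSystem

/-- `(𝐏₁, …, 𝐏_N)` is a solution on `[0, T]` of the large Riccati system, including its
positivity and invertibility constraints. Derivatives at `0` and `T` are one-sided. -/
structure IsRiccatiSolution (N : ℕ)
    (P : Fin N → ℝ → Matrix (Fin N × Fin n) (Fin N × Fin n) ℝ) : Prop where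
  symm : ∀ i, ∀ t ∈ Icc 0 g.T, (P i t).IsSymm
  deriv : ∀ i, ∀ t ∈ Icc 0 g.T,
    HasDerivWithinAt (P i) (-g.bigPhi (fun k => P k t) i) (Icc 0 g.T) t
  terminal : ∀ i, P i g.T = g.bigQf N i
  posDef : ∀ i, ∀ t ∈ Icc 0 g.T, (g.bigR (fun k => P k t) i).PosDef
  posDef_add : ∀ i, ∀ t ∈ Icc 0 g.T,
    (g.bigR (fun k => P k t) i + g.bigS (fun k => P k t) i).PosDef
  isUnit : ∀ t ∈ Icc 0 g.T, IsUnit (g.bigI (fun k => P k t))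

/-- The `(j, l)` block, of size `n × n`, of an `Nn × Nn` matrix. -/
def block {N : ℕ} (X : Matrix (Fin N × Fin n) (Fin N × Fin n) ℝ) (j l : Fin N) :
    Matrix (Fin n) (Fin n) ℝ :=
  Matrix.of fun a b => X (j, a) (l, b)

/-- `|Π₁| + N |Π₂| + N² |Π₃| + N² |Π₄|`, where `Π₁, Π₂, Π₃, Π₄` are the blocks of `𝐏₁ = X` in the
positions `(1,1)`, `(1,2)`, `(2,2)`, `(2,3)`. -/
noncomputable def rescaledSize {N : ℕ} (hN : 3 ≤ N)
    (X : Matrix (Fin N × Fin n) (Fin N × Fin n) ℝ) : ℝ :=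
  euclNorm (block X ⟨0, by omega⟩ ⟨0, by omega⟩)
    + N * euclNorm (block X ⟨0, by omega⟩ ⟨1, by omega⟩)
    + (N : ℝ) ^ 2 * euclNorm (block X ⟨1, by omega⟩ ⟨1, by omega⟩)
    + (N : ℝ) ^ 2 * euclNorm (block X ⟨1, by omega⟩ ⟨2, by omega⟩)

/-- Asymptotic solvability. The four blocks `Π₁, …, Π₄` exist only for `N ≥ 3`, and the condition
becomes weaker as `N₀` grows, so `N₀ ≥ 3` is no restriction. -/
def AsymptoticallySolvable : Prop :=
  ∃ N₀ : ℕ, ∃ hN₀ : 3 ≤ N₀, ∃ c₀ : ℝ, 0 < c₀ ∧ ∃ C : ℝ, ∀ N : ℕ, ∀ hN : N₀ ≤ N,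
    ∃ P : Fin N → ℝ → Matrix (Fin N × Fin n) (Fin N × Fin n) ℝ,
      g.IsRiccatiSolution N P ∧
      (∀ t ∈ Icc 0 g.T, rescaledSize (hN₀.trans hN) (P ⟨0, by omega⟩ t) ≤ C) ∧
      (∀ i, ∀ t ∈ Icc 0 g.T,
        (g.bigR (fun k => P k t) i - c₀ • (1 : Matrix (Fin m) (Fin m) ℝ)).PosSemidef) ∧
      (∀ t ∈ Icc 0 g.T, IsUnit (g.bigI (fun k => P k t)))

/-- `𝓡₁(Z) = R + B₁ᵀ Z B₁`. -/
def R₁ (Z : Matrix (Fin n) (Fin n) ℝ) : Matrix (Fin m) (Fin m) ℝ :=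
  g.R + g.B₁ᵀ * Z * g.B₁

/-- `Ψ₁(Λ₁) = Λ₁ B H Bᵀ Λ₁ - Λ₁ A - Aᵀ Λ₁ - Q`, where `H = 𝓡₁(Λ₁)⁻¹`. -/
noncomputable def Ψ₁ (L₁ : Matrix (Fin n) (Fin n) ℝ) : Matrix (Fin n) (Fin n) ℝ :=
  L₁ * g.B * (g.R₁ L₁)⁻¹ * g.Bᵀ * L₁ - L₁ * g.A - g.Aᵀ * L₁ - g.Q

/-- `Ψ₂(Λ₁, Λ₂) = -Λ₁ G - Λ₂ (A + G) - Aᵀ Λ₂ + Λ₁ B H Bᵀ Λ₂ + Λ₂ B H Bᵀ Λ₁ + Λ₂ B H Bᵀ Λ₂ + Q Γ`,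
where `H = 𝓡₁(Λ₁)⁻¹`. -/
noncomputable def Ψ₂ (L₁ L₂ : Matrix (Fin n) (Fin n) ℝ) : Matrix (Fin n) (Fin n) ℝ :=
  -(L₁ * g.G) - L₂ * (g.A + g.G) - g.Aᵀ * L₂
    + L₁ * g.B * (g.R₁ L₁)⁻¹ * g.Bᵀ * L₂
    + L₂ * g.B * (g.R₁ L₁)⁻¹ * g.Bᵀ * L₁
    + L₂ * g.B * (g.R₁ L₁)⁻¹ * g.Bᵀ * L₂
    + g.Q * g.Γ

/-- `(Λ₁, Λ₂)` is a solution on `[0, T]` of the low-dimensional Riccati system, including the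
constraint `𝓡₁(Λ₁(t)) > 0`. -/
structure IsLimitSolution (L₁ L₂ : ℝ → Matrix (Fin n) (Fin n) ℝ) : Prop where
  symm : ∀ t ∈ Icc 0 g.T, (L₁ t).IsSymm
  deriv₁ : ∀ t ∈ Icc 0 g.T, HasDerivWithinAt L₁ (g.Ψ₁ (L₁ t)) (Icc 0 g.T) t
  terminal₁ : L₁ g.T = g.Qf
  posDef : ∀ t ∈ Icc 0 g.T, (g.R₁ (L₁ t)).PosDef
  deriv₂ : ∀ t ∈ Icc 0 g.T, HasDerivWithinAt L₂ (g.Ψ₂ (L₁ t) (L₂ t)) (Icc 0 g.T) t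
  terminal₂ : L₂ g.T = -(g.Qf * g.Γf)

end LQGame

/-! The game is invariant under permutations of the players. The large Riccati system is a terminal
value problem whose right-hand side is C¹ wherever its constraints hold, so uniqueness forces every
solution to be exchangeable (`IsRiccatiSolution.relabel_eq`, `IsRiccatiSolution.eq_exch`): four n ×
n blocks of 𝐏₁ determine the whole tuple. Rescaled by 1, N, N², N², these blocks satisfy an ODE with
right-hand side `redField h`, h = 1/N (`exch_redField`). It is built from polynomials in h and the
entries and from the inverses of `R₁` and `redI`, and `redI` equals 1 at h = 0; hence it is C¹
jointly in h and the state, up to and including h = 0. At h = 0 it is triangular: the first two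
components form the limit system, and the other two obey an affine equation driven by them.

Both implications are then the same perturbation argument,
`exists_terminal_solution_near_approximate_solution`: an approximate solution is shadowed by an
exact one, with an accuracy requirement that depends only on the tube radius, the Lipschitz constant
and T. Given a limit solution, the affine equation extends it to a solution at h = 0
(`IsLimitSolution.exists_extension`), which is an O(1/N)-approximate solution at h = 1/N.
Conversely, the size bound and 𝐑ᵢ ≥ c₀ I confine all rescaled solutions to one compact set of
admissible states that does not depend on N, along which the tube constants are uniform
(`exists_uniform_neighbourhood`). The first two blocks for a single large N are then close enough to
solving the limit system to be shadowed by a solution of it; no subsequence or limit of solutions is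
taken. -/

/-! ### Shadowing, global existence and uniqueness for ODEs -/

section ODE

open Metric Filter Topology
open scoped NNReal

variable {E : Type*} [NormedAddCommGroup E] [NormedSpace ℝ E]

/-- The radial retraction of a normed space onto the closed ball of radius `δ` around `0`. -/
noncomputable def radialRetraction (δ : ℝ) (y : E) : E := (δ / max δ ‖y‖) • y

theorem radialRetraction_of_norm_le {δ : ℝ} (hδ : 0 < δ) {y : E} (hy : ‖y‖ ≤ δ) :
    radialRetraction δ y = y := by
  rw [radialRetraction, max_eq_left hy, div_self hδ.ne', one_smul]

theorem norm_radialRetraction_le {δ : ℝ} (hδ : 0 < δ) (y : E) : ‖radialRetraction δ y‖ ≤ δ := by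
  have hm : 0 < max δ ‖y‖ := lt_max_of_lt_left hδ
  rw [radialRetraction, norm_smul, Real.norm_of_nonneg (by positivity), div_mul_eq_mul_div,
    div_le_iff₀ hm]
  exact mul_le_mul_of_nonneg_left (le_max_right _ _) hδ.le

/-- The difference of the images splits into a scaled copy of a - b and a multiple of b caused by
the change of the scaling factor; each contributes at most ‖a - b‖, which gives the constant 2 in
any normed space. -/
theorem lipschitzWith_radialRetraction {δ : ℝ} (hδ : 0 < δ) :
    LipschitzWith 2 (radialRetraction δ : E → E) := by
  refine LipschitzWith.of_dist_le_mul fun a b => ?_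
  have hA : 0 < max δ ‖a‖ := lt_max_of_lt_left hδ
  have hB : 0 < max δ ‖b‖ := lt_max_of_lt_left hδ
  have hAB : |max δ ‖b‖ - max δ ‖a‖| ≤ ‖a - b‖ := by
    calc |max δ ‖b‖ - max δ ‖a‖| ≤ |‖b‖ - ‖a‖| := by
          simpa only [max_comm δ] using abs_max_sub_max_le_abs ‖b‖ ‖a‖ δ
      _ ≤ ‖b - a‖ := abs_norm_sub_norm_le b a
      _ = ‖a - b‖ := norm_sub_rev b a
  set A := max δ ‖a‖ with hAdef
  set B := max δ ‖b‖ with hBdef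
  have hsplit : radialRetraction δ a - radialRetraction δ b
      = (δ / A) • (a - b) + (δ / A * ((B - A) / B)) • b := by
    have : δ / A * ((B - A) / B) = δ / A - δ / B := by field_simp
    rw [this, radialRetraction, radialRetraction, ← hAdef, ← hBdef]
    module
  have hδA : δ / A ≤ 1 := (div_le_one hA).2 (le_max_left _ _)
  have hδA0 : 0 ≤ δ / A := by positivity
  have hb : ‖b‖ / B ≤ 1 := (div_le_one hB).2 (le_max_right _ _)
  rw [dist_eq_norm, dist_eq_norm, hsplit]
  calc ‖(δ / A) • (a - b) + (δ / A * ((B - A) / B)) • b‖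
      ≤ δ / A * ‖a - b‖ + δ / A * (|B - A| * (‖b‖ / B)) := by
        refine (norm_add_le _ _).trans_eq ?_
        rw [norm_smul, norm_smul, Real.norm_of_nonneg hδA0, norm_mul, Real.norm_of_nonneg hδA0,
          norm_div, Real.norm_eq_abs, Real.norm_of_nonneg hB.le]
        ring
    _ ≤ 1 * ‖a - b‖ + 1 * (‖a - b‖ * 1) := by gcongr
    _ = ((2 : ℝ≥0) : ℝ) * ‖a - b‖ := by
        push_cast
        ring

theorem HasDerivWithinAt.comp_const_sub_Icc {T : ℝ} {f : ℝ → E} {f' : E} {t : ℝ}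
    (hf : HasDerivWithinAt f f' (Icc 0 T) (T - t)) :
    HasDerivWithinAt (fun s => f (T - s)) (-f') (Icc 0 T) t := by
  have h1 : HasDerivWithinAt (fun s : ℝ => T - s) (-1) (Icc 0 T) t := by
    simpa using (hasDerivWithinAt_id t (Icc 0 T)).const_sub T
  have h2 : MapsTo (fun s : ℝ => T - s) (Icc 0 T) (Icc 0 T) := fun s hs =>
    ⟨by linarith [hs.2], by linarith [hs.1]⟩
  simpa [Function.comp_def] using HasDerivWithinAt.scomp t hf h1 h2

/-- Homogeneity in the data: when the initial error and the defect are both ε, the admissible ε is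
found by a division. -/
theorem gronwallBound_self_mul (ε K x : ℝ) :
    gronwallBound ε K ε x = ε * gronwallBound 1 K 1 x := by
  unfold gronwallBound
  split_ifs <;> ring

/-- Every approximate solution of an ODE that is Lipschitz on a tube around it is shadowed by an
exact solution with nearby initial value; the required accuracy depends only on the radius of the
tube, the Lipschitz constant and the length of the time interval. -/
theorem exists_solution_near_approximate_solution [CompleteSpace E] (T : ℝ) (hT : 0 < T)
    (K : ℝ≥0) {δ : ℝ} (hδ : 0 < δ) :
    ∃ ε > 0, ∀ (v : ℝ → E → E) (z z' : ℝ → E) (x₀ : E),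
      (∀ t ∈ Icc 0 T, HasDerivWithinAt z (z' t) (Icc 0 T) t) →
      (∀ t ∈ Icc 0 T, LipschitzOnWith K (v t) (closedBall (z t) δ)) →
      ContinuousOn (Function.uncurry v) {p | p.1 ∈ Icc 0 T ∧ p.2 ∈ closedBall (z p.1) δ} →
      (∀ t ∈ Icc 0 T, ‖z' t - v t (z t)‖ ≤ ε) → ‖z 0 - x₀‖ ≤ ε →
      ∃ x : ℝ → E, x 0 = x₀ ∧ (∀ t ∈ Icc 0 T, HasDerivWithinAt x (v t (x t)) (Icc 0 T) t) ∧
        ∀ t ∈ Icc 0 T, x t ∈ closedBall (z t) δ := by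
  have hg : 0 < gronwallBound 1 (K * 2 : ℝ≥0) 1 T := by
    refine lt_of_lt_of_le one_pos ?_
    have := gronwallBound_mono zero_le_one zero_le_one (NNReal.coe_nonneg (K * 2)) hT.le
    rwa [gronwallBound_x0] at this
  -- With this ε, initial error and defect grow to exactly δ at time T. The factor 2 is the
  -- Lipschitz constant of the radial retraction.
  refine ⟨δ / gronwallBound 1 (K * 2 : ℝ≥0) 1 T, div_pos hδ hg, ?_⟩
  intro v z z' x₀ hz hv hcont hzv hx₀
  set ε := δ / gronwallBound 1 (K * 2 : ℝ≥0) 1 T with hε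
  have hε0 : 0 < ε := div_pos hδ hg
  have hzc : ContinuousOn z (Icc 0 T) := fun t ht => (hz t ht).continuousWithinAt
  have hmem : ∀ t (x : E), z t + radialRetraction δ (x - z t) ∈ closedBall (z t) δ := by
    intro t x
    simpa [mem_closedBall, dist_eq_norm] using norm_radialRetraction_le hδ (x - z t)
  -- Precomposing with the retraction onto the tube makes the field globally Lipschitz and bounded
  -- without changing it inside the tube.
  set w : ℝ → E → E := fun t x => v t (z t + radialRetraction δ (x - z t)) with hw
  have hwv : ∀ t, ∀ x ∈ closedBall (z t) δ, w t x = v t x := by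
    intro t x hx
    rw [mem_closedBall, dist_eq_norm] at hx
    simp [hw, radialRetraction_of_norm_le hδ hx]
  have hwlip : ∀ t ∈ Icc 0 T, LipschitzWith (K * 2) (w t) := by
    intro t ht
    have h1 : LipschitzWith 2 fun x => z t + radialRetraction δ (x - z t) := by
      refine LipschitzWith.of_dist_le_mul fun a b => ?_
      simpa using (lipschitzWith_radialRetraction (E := E) hδ).dist_le_mul (a - z t) (b - z t)
    rw [← lipschitzOnWith_univ] at h1 ⊢
    exact (hv t ht).comp h1 fun x _ => hmem t x
  have hwcont : ∀ x, ContinuousOn (w · x) (Icc 0 T) := by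
    intro x
    refine hcont.comp (continuousOn_id.prodMk (hzc.add ?_)) fun t ht => ⟨ht, hmem t x⟩
    exact (lipschitzWith_radialRetraction hδ).continuous.comp_continuousOn
      (continuousOn_const.sub hzc)
  obtain ⟨M, hM⟩ : ∃ M, ∀ t ∈ Icc 0 T, ‖v t (z t)‖ ≤ M := by
    refine isCompact_Icc.exists_bound_of_continuousOn
      (hcont.comp (continuousOn_id.prodMk hzc) fun t ht => ⟨ht, ?_⟩)
    exact mem_closedBall_self hδ.le
  have hM0 : 0 ≤ M := (norm_nonneg _).trans (hM 0 ⟨le_rfl, hT.le⟩)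
  have hwbound : ∀ t ∈ Icc 0 T, ∀ x, ‖w t x‖ ≤ M + K * δ := by
    intro t ht x
    have h1 := (hv t ht).dist_le_mul _ (hmem t x) _ (mem_closedBall_self hδ.le)
    rw [dist_eq_norm] at h1
    have h2 : (K : ℝ) * dist (z t + radialRetraction δ (x - z t)) (z t) ≤ K * δ :=
      mul_le_mul_of_nonneg_left (hmem t x) K.coe_nonneg
    calc ‖w t x‖ = ‖v t (z t) + (w t x - v t (z t))‖ := by rw [add_sub_cancel]
      _ ≤ M + K * δ := (norm_add_le _ _).trans (add_le_add (hM t ht) (h1.trans h2))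
  -- Since L bounds w everywhere, a solution stays within L * T of x₀, so Picard–Lindelöf covers all
  -- of [0, T] in one step.
  let L : ℝ≥0 := ⟨M + K * δ, by positivity⟩
  have hPL : IsPicardLindelof w (⟨0, le_rfl, hT.le⟩ : Icc 0 T) x₀ (L * ⟨T, hT.le⟩) 0 L (K * 2) :=
    { lipschitzOnWith := fun t ht => (hwlip t ht).lipschitzOnWith
      continuousOn := fun x _ => hwcont x
      norm_le := fun t ht x _ => hwbound t ht x
      mul_max_le := by
        simp only [sub_zero, sub_self, max_eq_left hT.le, NNReal.coe_zero]
        exact le_rfl }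
  obtain ⟨x, hx0, hx⟩ := hPL.exists_eq_forall_mem_Icc_hasDerivWithinAt₀
  have hIci : ∀ {f : ℝ → E} {f' : E} {t : ℝ}, t ∈ Ico 0 T →
      HasDerivWithinAt f f' (Icc 0 T) t → HasDerivWithinAt f f' (Ici t) t := by
    intro f f' t ht h
    exact h.mono_of_mem_nhdsWithin (mem_of_superset (Icc_mem_nhdsGE ht.2)
      (Icc_subset_Icc_left ht.1))
  have hnear : ∀ t ∈ Icc 0 T, x t ∈ closedBall (z t) δ := by
    intro t ht
    -- Grönwall for the truncated field needs no prior confinement to the tube; its conclusion is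
    -- that x never leaves the tube, where w and v agree.
    have h1 := dist_le_of_approx_trajectories_ODE_of_mem (v := w) (s := fun _ => univ)
      (K := K * 2) (f := x) (f' := fun t => w t (x t)) (g := z) (g' := z') (a := 0) (b := T)
      (εf := 0) (εg := ε) (δ := ε)
      (fun t ht => (hwlip t (Ico_subset_Icc_self ht)).lipschitzOnWith)
      (fun t ht => (hx t ht).continuousWithinAt)
      (fun t ht => hIci ht (hx t (Ico_subset_Icc_self ht))) (fun t _ => by simp)
      (fun _ _ => mem_univ _) hzc (fun t ht => hIci ht (hz t (Ico_subset_Icc_self ht)))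
      (fun t ht => by
        rw [hwv t _ (mem_closedBall_self hδ.le), dist_eq_norm]
        exact hzv t (Ico_subset_Icc_self ht)) (fun _ _ => mem_univ _)
      (by
        rw [hx0, dist_eq_norm, norm_sub_rev]
        exact hx₀) t ht
    rw [zero_add, sub_zero] at h1
    rw [mem_closedBall]
    calc dist (x t) (z t) ≤ gronwallBound ε (K * 2 : ℝ≥0) ε t := h1
      _ ≤ gronwallBound ε (K * 2 : ℝ≥0) ε T :=
        gronwallBound_mono hε0.le hε0.le (NNReal.coe_nonneg _) ht.2
      _ = δ := by rw [gronwallBound_self_mul, hε, div_mul_cancel₀ _ hg.ne']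
  refine ⟨x, hx0, fun t ht => ?_, hnear⟩
  rw [← hwv t _ (hnear t ht)]
  exact hx t ht

/-- The version of `exists_solution_near_approximate_solution` with a prescribed terminal value. -/
theorem exists_terminal_solution_near_approximate_solution [CompleteSpace E] (T : ℝ) (hT : 0 < T)
    (K : ℝ≥0) {δ : ℝ} (hδ : 0 < δ) :
    ∃ ε > 0, ∀ (v : ℝ → E → E) (z z' : ℝ → E) (xT : E),
      (∀ t ∈ Icc 0 T, HasDerivWithinAt z (z' t) (Icc 0 T) t) →
      (∀ t ∈ Icc 0 T, LipschitzOnWith K (v t) (closedBall (z t) δ)) →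
      ContinuousOn (Function.uncurry v) {p | p.1 ∈ Icc 0 T ∧ p.2 ∈ closedBall (z p.1) δ} →
      (∀ t ∈ Icc 0 T, ‖z' t - v t (z t)‖ ≤ ε) → ‖z T - xT‖ ≤ ε →
      ∃ x : ℝ → E, x T = xT ∧ (∀ t ∈ Icc 0 T, HasDerivWithinAt x (v t (x t)) (Icc 0 T) t) ∧
        ∀ t ∈ Icc 0 T, x t ∈ closedBall (z t) δ := by
  obtain ⟨ε, hε, h⟩ := exists_solution_near_approximate_solution (E := E) T hT K hδ
  refine ⟨ε, hε, fun v z z' xT hz hv hc hzv hzT => ?_⟩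
  have hrev : ∀ t ∈ Icc 0 T, T - t ∈ Icc 0 T := fun t ht =>
    ⟨by linarith [ht.2], by linarith [ht.1]⟩
  -- Reversing time turns the terminal condition into an initial one.
  obtain ⟨x, hx0, hx, hxz⟩ := h (fun t y => -v (T - t) y) (fun t => z (T - t))
    (fun t => -z' (T - t)) xT (fun t ht => (hz _ (hrev t ht)).comp_const_sub_Icc)
    (fun t ht => (hv _ (hrev t ht)).neg)
    (by
      refine ContinuousOn.neg (hc.comp (f := fun p : ℝ × E => (T - p.1, p.2))
        (by fun_prop) fun p hp => ⟨hrev _ hp.1, hp.2⟩))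
    (fun t ht => by
      rw [neg_sub_neg, norm_sub_rev]
      exact hzv _ (hrev t ht))
    (by simpa using hzT)
  refine ⟨fun t => x (T - t), by simpa using hx0, fun t ht => ?_, fun t ht => ?_⟩
  · simpa using (hx _ (hrev t ht)).comp_const_sub_Icc
  · simpa using hxz _ (hrev t ht)

/-- Global existence for a globally Lipschitz ODE with a prescribed terminal value. -/
theorem exists_terminal_solution_of_lipschitzWith [CompleteSpace E] {T : ℝ} (hT : 0 < T)
    {K : ℝ≥0} {v : ℝ → E → E} (hv : ∀ t ∈ Icc 0 T, LipschitzWith K (v t))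
    (hc : ContinuousOn (Function.uncurry v) (Icc 0 T ×ˢ univ)) (xT : E) :
    ∃ x : ℝ → E, x T = xT ∧ ∀ t ∈ Icc 0 T, HasDerivWithinAt x (v t (x t)) (Icc 0 T) t := by
  obtain ⟨ε, hε, h⟩ := exists_terminal_solution_near_approximate_solution (E := E) T hT K one_pos
  obtain ⟨M, hM⟩ := isCompact_Icc.exists_bound_of_continuousOn
    (hc.comp (f := fun t => (t, (0 : E))) (by fun_prop) fun t ht => ⟨ht, mem_univ _⟩)
  have hpos : 0 < max 1 (max M ‖xT‖) := lt_max_of_lt_left one_pos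
  -- The field y ↦ η v(t, y / η) has the same Lipschitz constant K, so the same ε serves for every
  -- η. For this η the zero function is an ε-approximate solution with terminal error at most ε; the
  -- shadowing solution is scaled back at the end.
  set η := ε / max 1 (max M ‖xT‖) with hη
  have hη0 : 0 < η := div_pos hε hpos
  have hηle : ∀ r, r ≤ max 1 (max M ‖xT‖) → η * r ≤ ε := fun r hr => by
    rw [hη, div_mul_eq_mul_div, div_le_iff₀ hpos]
    exact mul_le_mul_of_nonneg_left hr hε.le
  obtain ⟨x, hxT, hx, -⟩ := h (fun t y => η • v t (η⁻¹ • y)) (fun _ => 0) (fun _ => 0) (η • xT)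
    (fun t _ => hasDerivWithinAt_const _ _ _)
    (fun t ht => by
      refine (LipschitzWith.of_dist_le_mul fun a b => ?_).lipschitzOnWith
      rw [dist_smul₀, Real.norm_of_nonneg hη0.le]
      have := (hv t ht).dist_le_mul (η⁻¹ • a) (η⁻¹ • b)
      rw [dist_smul₀, Real.norm_of_nonneg (inv_nonneg.2 hη0.le)] at this
      calc η * dist (v t (η⁻¹ • a)) (v t (η⁻¹ • b)) ≤ η * (K * (η⁻¹ * dist a b)) := by gcongr
        _ = K * dist a b := by field_simp)
    (by
      refine ContinuousOn.const_smul (hc.comp (f := fun p : ℝ × E => (p.1, η⁻¹ • p.2))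
        (by fun_prop) fun p hp => ⟨hp.1, mem_univ _⟩) η)
    (fun t ht => by
      rw [smul_zero, zero_sub, norm_neg, norm_smul, Real.norm_of_nonneg hη0.le]
      exact hηle _ ((hM t ht).trans ((le_max_left _ _).trans (le_max_right _ _))))
    (by
      rw [zero_sub, norm_neg, norm_smul, Real.norm_of_nonneg hη0.le]
      exact hηle _ ((le_max_right _ _).trans (le_max_right _ _)))
  refine ⟨fun t => η⁻¹ • x t, by simp [hxT, hη0.ne'], fun t ht => ?_⟩
  have h2 := (hx t ht).const_smul η⁻¹
  rw [inv_smul_smul₀ hη0.ne'] at h2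
  exact h2

/-- A locally uniform version, along a compact set, of local Lipschitz continuity together with a
family of properties that hold locally for small values of a parameter. -/
theorem IsCompact.exists_uniform_lipschitzOnWith {F : Type*} [NormedAddCommGroup F]
    [NormedSpace ℝ F] {s : Set E} (hs : IsCompact s) {f : E → F}
    (hf : ∀ p ∈ s, ContDiffAt ℝ 1 f p) (q : ℝ → E → Prop)
    (hq : ∀ c c' x, c' ≤ c → q c x → q c' x)
    (hqs : ∀ p ∈ s, ∃ c > 0, ∀ᶠ x in 𝓝 p, q c x) :
    ∃ δ > 0, ∃ c > 0, ∃ K : ℝ≥0, ∀ p ∈ s, LipschitzOnWith K f (closedBall p δ) ∧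
      ∀ x ∈ closedBall p δ, q c x := by
  refine hs.induction_on (p := fun s => ∃ δ > 0, ∃ c > 0, ∃ K : ℝ≥0, ∀ p ∈ s,
    LipschitzOnWith K f (closedBall p δ) ∧ ∀ x ∈ closedBall p δ, q c x) ?_ ?_ ?_ ?_
  · exact ⟨1, one_pos, 1, one_pos, 0, by simp⟩
  · rintro s t hst ⟨δ, hδ, c, hc, K, h⟩
    exact ⟨δ, hδ, c, hc, K, fun p hp => h p (hst hp)⟩
  · rintro s t ⟨δ, hδ, c, hc, K, h⟩ ⟨δ', hδ', c', hc', K', h'⟩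
    refine ⟨min δ δ', lt_min hδ hδ', min c c', lt_min hc hc', max K K', ?_⟩
    rintro p (hp | hp)
    · exact ⟨((h p hp).1.mono (closedBall_subset_closedBall (min_le_left _ _))).weaken
        (le_max_left _ _), fun x hx => hq _ _ _ (min_le_left _ _)
        ((h p hp).2 x (closedBall_subset_closedBall (min_le_left _ _) hx))⟩
    · exact ⟨((h' p hp).1.mono (closedBall_subset_closedBall (min_le_right _ _))).weaken
        (le_max_right _ _), fun x hx => hq _ _ _ (min_le_right _ _)
        ((h' p hp).2 x (closedBall_subset_closedBall (min_le_right _ _) hx))⟩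
  · intro p hp
    obtain ⟨K, u, hu, hK⟩ := (hf p hp).exists_lipschitzOnWith
    obtain ⟨c, hc, hcq⟩ := hqs p hp
    obtain ⟨r, hr, hru⟩ := Metric.mem_nhds_iff.1 (inter_mem hu hcq)
    refine ⟨ball p (r / 2), mem_nhdsWithin_of_mem_nhds (ball_mem_nhds _ (half_pos hr)), r / 4,
      by positivity, c, hc, K, fun y hy => ?_⟩
    have hsub : closedBall y (r / 4) ⊆ ball p r := by
      intro w hw
      rw [mem_ball] at hy ⊢
      rw [mem_closedBall] at hw
      linarith [dist_triangle w y p]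
    exact ⟨hK.mono fun w hw => (hru (hsub hw)).1, fun w hw => (hru (hsub hw)).2⟩

/-- No convexity is needed: points at distance at most δ share a ball with a uniform Lipschitz
constant, and for points further apart the bound on f gives the quotient 2M / δ. -/
theorem IsCompact.exists_lipschitzOnWith_of_contDiffAt {F : Type*} [NormedAddCommGroup F]
    [NormedSpace ℝ F] {s : Set E} (hs : IsCompact s) {f : E → F}
    (hf : ∀ p ∈ s, ContDiffAt ℝ 1 f p) : ∃ K : ℝ≥0, LipschitzOnWith K f s := by
  obtain ⟨δ, hδ, -, -, K, hK⟩ := hs.exists_uniform_lipschitzOnWith hf (fun _ _ => True)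
    (fun _ _ _ _ _ => trivial) (fun _ _ => ⟨1, one_pos, .of_forall fun _ => trivial⟩)
  obtain ⟨M, hM⟩ := hs.exists_bound_of_continuousOn
    (fun p hp => (hf p hp).continuousAt.continuousWithinAt)
  refine ⟨max K (2 * M / δ).toNNReal, LipschitzOnWith.of_dist_le_mul fun a ha b hb => ?_⟩
  rcases le_or_gt (dist a b) δ with hab | hab
  · refine ((hK b hb).1.dist_le_mul a hab b (mem_closedBall_self hδ.le)).trans ?_
    gcongr
    exact le_max_left _ _
  · have h1 : dist (f a) (f b) ≤ 2 * M := by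
      rw [dist_eq_norm]
      linarith [norm_sub_le (f a) (f b), hM a ha, hM b hb]
    have hM0 : 0 ≤ M := (norm_nonneg _).trans (hM a ha)
    calc dist (f a) (f b) ≤ 2 * M := h1
      _ = 2 * M / δ * δ := by field_simp
      _ ≤ 2 * M / δ * dist a b := by gcongr
      _ ≤ _ := by
        gcongr
        exact (Real.le_coe_toNNReal _).trans (NNReal.coe_le_coe.2 (le_max_right _ _))

/-- The union of the two trajectories is compact, so v is Lipschitz on it, and Grönwall uniqueness
runs backwards from T. -/
theorem eqOn_Icc_of_hasDerivWithinAt_of_contDiffAt {T : ℝ} {v : E → E} {x y : ℝ → E}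
    (hx : ∀ t ∈ Icc 0 T, HasDerivWithinAt x (v (x t)) (Icc 0 T) t)
    (hy : ∀ t ∈ Icc 0 T, HasDerivWithinAt y (v (y t)) (Icc 0 T) t)
    (hvx : ∀ t ∈ Icc 0 T, ContDiffAt ℝ 1 v (x t))
    (hvy : ∀ t ∈ Icc 0 T, ContDiffAt ℝ 1 v (y t)) (hT : x T = y T) : EqOn x y (Icc 0 T) := by
  have hxc : ContinuousOn x (Icc 0 T) := fun t ht => (hx t ht).continuousWithinAt
  have hyc : ContinuousOn y (Icc 0 T) := fun t ht => (hy t ht).continuousWithinAt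
  obtain ⟨K, hK⟩ := ((isCompact_Icc.image_of_continuousOn hxc).union
    (isCompact_Icc.image_of_continuousOn hyc)).exists_lipschitzOnWith_of_contDiffAt (f := v) (by
      rintro p (⟨t, ht, rfl⟩ | ⟨t, ht, rfl⟩)
      exacts [hvx t ht, hvy t ht])
  have hIic : ∀ {f : ℝ → E} {f' : E} {t : ℝ}, t ∈ Ioc 0 T →
      HasDerivWithinAt f f' (Icc 0 T) t → HasDerivWithinAt f f' (Iic t) t := by
    intro f f' t ht h
    exact h.mono_of_mem_nhdsWithin (mem_of_superset (Icc_mem_nhdsLE ht.1)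
      (Icc_subset_Icc_right ht.2))
  exact ODE_solution_unique_of_mem_Icc_left (v := fun _ => v) (fun t _ => hK) hxc
    (fun t ht => hIic ht (hx t (Ioc_subset_Icc_self ht)))
    (fun t ht => Or.inl ⟨t, Ioc_subset_Icc_self ht, rfl⟩) hyc
    (fun t ht => hIic ht (hy t (Ioc_subset_Icc_self ht)))
    (fun t ht => Or.inr ⟨t, Ioc_subset_Icc_self ht, rfl⟩) hT

end ODE

/-! ### Smoothness of matrix operations and stability of positive definiteness -/

section MatrixCalculus

open Filter Topology
open scoped Matrix.Norms.Frobenius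

variable {E : Type*} [NormedAddCommGroup E] [NormedSpace ℝ E]
variable {a b c : Type*}

section

variable [Fintype a] [Fintype b] [Fintype c]

theorem Matrix.isBoundedBilinearMap_mul :
    IsBoundedBilinearMap ℝ fun p : Matrix a b ℝ × Matrix b c ℝ => p.1 * p.2 where
  add_left X Y Z := Matrix.add_mul X Y Z
  smul_left r X Y := Matrix.smul_mul r X Y
  add_right X Y Z := Matrix.mul_add X Y Z
  smul_right r X Y := Matrix.mul_smul X r Y
  bound := ⟨1, one_pos, fun X Y => by simpa using Matrix.frobenius_norm_mul X Y⟩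

@[fun_prop]
theorem ContDiffAt.matrix_mul {k : WithTop ℕ∞} {f : E → Matrix a b ℝ} {g : E → Matrix b c ℝ}
    {x : E} (hf : ContDiffAt ℝ k f x) (hg : ContDiffAt ℝ k g x) :
    ContDiffAt ℝ k (fun y => f y * g y) x :=
  (Matrix.isBoundedBilinearMap_mul (a := a) (b := b) (c := c)).contDiff.contDiffAt.comp x
    (hf.prodMk hg)

@[fun_prop]
theorem ContDiffAt.matrix_transpose {k : WithTop ℕ∞} {f : E → Matrix a b ℝ} {x : E}
    (hf : ContDiffAt ℝ k f x) : ContDiffAt ℝ k (fun y => (f y)ᵀ) x :=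
  ((Matrix.transposeLinearEquiv a b ℝ ℝ).toLinearMap.toContinuousLinearMap.contDiff.contDiffAt).comp
    x hf

theorem ContDiffAt.matrix_inv [DecidableEq a] {k : WithTop ℕ∞} {f : E → Matrix a a ℝ} {x : E}
    (hf : ContDiffAt ℝ k f x) (hx : IsUnit (f x)) : ContDiffAt ℝ k (fun y => (f y)⁻¹) x := by
  obtain ⟨u, hu⟩ := hx
  have h := contDiffAt_ringInverse ℝ (n := k) u
  rw [hu] at h
  simp only [Matrix.nonsing_inv_eq_ringInverse]
  exact h.comp x hf

/-- The quadratic forms of the symmetric matrices near a positive definite matrix are uniformly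
positive. -/
theorem Matrix.PosDef.exists_eventually_sub_smul_one_posSemidef [DecidableEq a] {M : Matrix a a ℝ}
    (hM : M.PosDef) :
    ∃ r > (0 : ℝ), ∀ᶠ X in 𝓝 M, X.IsSymm → (X - r • (1 : Matrix a a ℝ)).PosSemidef := by
  -- This is the Euclidean unit sphere, written with the dot product because the norm on `a → ℝ` is
  -- the sup norm.
  let S : Set (a → ℝ) := {x | x ⬝ᵥ x = 1}
  have hS : IsCompact S := by
    refine Metric.isCompact_of_isClosed_isBounded
      (isClosed_eq (by fun_prop) continuous_const) ?_
    refine (Metric.isBounded_closedBall (x := (0 : a → ℝ)) (r := 1)).subset fun x hx => ?_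
    rw [mem_closedBall_zero_iff, pi_norm_le_iff_of_nonneg zero_le_one]
    intro i
    have h1 : x i * x i ≤ x ⬝ᵥ x :=
      Finset.single_le_sum (f := fun i => x i * x i) (fun i _ => mul_self_nonneg _)
        (Finset.mem_univ i)
    rw [show x ⬝ᵥ x = 1 from hx] at h1
    exact abs_le_of_sq_le_sq' (by nlinarith) zero_le_one |> abs_le.2
  have hcont : Continuous fun p : Matrix a a ℝ × (a → ℝ) => p.2 ⬝ᵥ (p.1 *ᵥ p.2) := by fun_prop
  have hpos : ∀ x ∈ S, 0 < x ⬝ᵥ (M *ᵥ x) := fun x hx => by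
    refine hM.dotProduct_mulVec_pos (x := x) ?_
    rintro rfl
    simp [S] at hx
  obtain ⟨r, hr, hrS⟩ : ∃ r > (0 : ℝ), ∀ x ∈ S, r < x ⬝ᵥ (M *ᵥ x) := by
    -- The sphere is empty when the index type is; otherwise r is half the minimum of the quadratic
    -- form.
    rcases S.eq_empty_or_nonempty with hS0 | hS0
    · exact ⟨1, one_pos, by simp [hS0]⟩
    · obtain ⟨x, hx, hmin⟩ := hS.exists_isMinOn hS0
        (hcont.comp (Continuous.prodMk_right M)).continuousOn
      refine ⟨x ⬝ᵥ (M *ᵥ x) / 2, half_pos (hpos x hx), fun y hy => ?_⟩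
      have := hmin hy
      have h2 := hpos x hx
      simp only [mem_ofPred_eq, Function.comp_apply] at this
      linarith
  refine ⟨r, hr, ?_⟩
  have hev : ∀ᶠ X in 𝓝 M, ∀ x ∈ S, r < x ⬝ᵥ (X *ᵥ x) :=
    hS.eventually_forall_of_forall_eventually fun x hx =>
      hcont.continuousAt.eventually_const_lt (hrS x hx)
  filter_upwards [hev] with X hX hsymm
  refine .of_dotProduct_mulVec_nonneg ?_ fun x => ?_
  · rw [IsHermitian, conjTranspose_eq_transpose_of_trivial, transpose_sub, transpose_smul,
      transpose_one, hsymm.eq]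
  · rw [star_trivial, sub_mulVec, smul_mulVec, one_mulVec, dotProduct_sub, dotProduct_smul,
      smul_eq_mul, sub_nonneg]
    rcases eq_or_ne x 0 with rfl | hx
    · simp
    · have hxx : 0 < x ⬝ᵥ x := by simpa using dotProduct_star_self_pos_iff.2 hx
      set s := √(x ⬝ᵥ x)
      have hs : s * s = x ⬝ᵥ x := Real.mul_self_sqrt hxx.le
      have hs0 : 0 < s := Real.sqrt_pos.2 hxx
      have h1 := hX (s⁻¹ • x) (by
        simp only [S, mem_ofPred_eq, dotProduct_smul, smul_dotProduct, smul_eq_mul, ← hs]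
        field_simp)
      rw [mulVec_smul, dotProduct_smul, smul_dotProduct, smul_eq_mul, smul_eq_mul, ← mul_assoc,
        ← mul_inv, hs, inv_mul_eq_div, lt_div_iff₀ hxx] at h1
      exact h1.le

end

theorem Matrix.PosSemidef.posDef_of_sub_smul_one [DecidableEq a] {M : Matrix a a ℝ} {r : ℝ}
    (hr : 0 < r) (h : (M - r • (1 : Matrix a a ℝ)).PosSemidef) : M.PosDef := by
  have := (Matrix.PosDef.one (n := a) (R := ℝ)).smul hr |>.add_posSemidef h
  simpa using this

theorem Matrix.PosSemidef.sub_smul_one_mono [DecidableEq a] {M : Matrix a a ℝ} {r r' : ℝ}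
    (hr : r' ≤ r) (h : (M - r • (1 : Matrix a a ℝ)).PosSemidef) :
    (M - r' • (1 : Matrix a a ℝ)).PosSemidef := by
  have := h.add ((Matrix.PosSemidef.one (n := a) (R := ℝ)).smul (sub_nonneg.2 hr))
  convert this using 1
  module

theorem Matrix.isClosed_setOf_posSemidef [Fintype a] : IsClosed {M : Matrix a a ℝ | M.PosSemidef} := by
  simp only [posSemidef_iff_dotProduct_mulVec, ofPred_and, ofPred_forall, IsHermitian]
  refine (isClosed_eq (by fun_prop) continuous_id).inter (isClosed_iInter fun x => ?_)
  exact isClosed_le continuous_const (by fun_prop)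

/-- Differentiability depends only on the topology, which on matrices is the product topology, so
derivatives are entrywise. -/
theorem hasDerivWithinAt_matrix [Fintype a] [Fintype b] {f : ℝ → Matrix a b ℝ} {f' : Matrix a b ℝ} {s : Set ℝ} {t : ℝ} :
    HasDerivWithinAt f f' s t ↔ ∀ i j, HasDerivWithinAt (fun u => f u i j) (f' i j) s t := by
  have h : HasDerivWithinAt f f' s t ↔
      HasDerivWithinAt (fun u i => f u i : ℝ → a → b → ℝ) (fun i => f' i) s t := Iff.rfl
  rw [h, hasDerivWithinAt_pi]
  exact forall_congr' fun i => hasDerivWithinAt_pi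

end MatrixCalculus

section SubmatrixMul

variable {a b c d : Type*}

theorem Matrix.submatrix_id_mul [Fintype b] (X : Matrix a b ℝ) (Y : Matrix b c ℝ) (f : d → a) :
    X.submatrix f id * Y = (X * Y).submatrix f id := by
  ext
  simp [mul_apply]

theorem Matrix.mul_submatrix_id [Fintype b] (X : Matrix a b ℝ) (Y : Matrix b c ℝ) (f : d → c) :
    X * Y.submatrix id f = (X * Y).submatrix id f := by
  ext
  simp [mul_apply]

end SubmatrixMul

/-! ### Symmetry and permutation equivariance of the large system, and exchangeability of its
solutions -/

namespace LQGame

variable {n m : ℕ} (g : LQGame n m) {N : ℕ}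

section Symmetry

variable {P : Fin N → Matrix (Fin N × Fin n) (Fin N × Fin n) ℝ}

theorem bigR_isSymm (hR : g.R.IsSymm) {k : Fin N} (hP : (P k).IsSymm) : (g.bigR P k).IsSymm := by
  simp [IsSymm, bigR, hR.eq, hP.eq, Matrix.mul_assoc]

theorem bigS_isSymm {k : Fin N} (hP : (P k).IsSymm) : (g.bigS P k).IsSymm := by
  simp [IsSymm, bigS, hP.eq, Matrix.mul_assoc]

/-- Transposition exchanges the two drift terms with each other, likewise the two sums linear in 𝐔ₖ,
and fixes every other term. -/
theorem bigPhi_isSymm (hQ : g.Q.IsSymm) (hR : g.R.IsSymm) (hP : ∀ k, (P k).IsSymm) (i : Fin N) :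
    (g.bigPhi P i).IsSymm := by
  have hH : ∀ k, ((g.bigR P k)⁻¹)ᵀ = (g.bigR P k)⁻¹ := fun k => by
    rw [transpose_nonsing_inv, (g.bigR_isSymm hR (hP k)).eq]
  have hS : ∀ k, (g.bigS P k)ᵀ = g.bigS P k := fun k => (g.bigS_isSymm (hP k)).eq
  have hQ' : (g.bigQ N i)ᵀ = g.bigQ N i := by simp [bigQ, hQ.eq, Matrix.mul_assoc]
  simp only [IsSymm, bigPhi, transpose_add, transpose_sub, transpose_mul, transpose_transpose,
    transpose_sum, hH, hS, hQ', (hP _).eq, Matrix.mul_assoc, Matrix.mul_sum]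
  abel

end Symmetry

section Permutation

variable (σ : Equiv.Perm (Fin N))

/-- The permutation of the coordinates of the joint state induced by a permutation of the
players. -/
def stateperm (n : ℕ) (σ : Equiv.Perm (Fin N)) : Fin N × Fin n ≃ Fin N × Fin n :=
  σ.prodCongr (Equiv.refl _)

/-- The action of a permutation of the players on tuples of `Nn × Nn` matrices. -/
def relabel (P : Fin N → Matrix (Fin N × Fin n) (Fin N × Fin n) ℝ) :
    Fin N → Matrix (Fin N × Fin n) (Fin N × Fin n) ℝ :=
  fun i => (P (σ i)).submatrix (stateperm n σ) (stateperm n σ)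

theorem bigA_relabel : g.bigA N = (g.bigA N).submatrix (stateperm n σ) (stateperm n σ) := by
  ext p q
  simp [bigA, stateperm]

theorem bigB₀_relabel : g.bigB₀ N = (g.bigB₀ N).submatrix (stateperm n σ) id := by
  ext p q
  simp [bigB₀, stateperm]

theorem bigBhat_relabel (k : Fin N) :
    g.bigBhat N k = (g.bigBhat N (σ k)).submatrix (stateperm n σ) id := by
  ext p q
  simp [bigBhat, stateperm]

theorem bigB_relabel (k : Fin N) :
    g.bigB N k = (g.bigB N (σ k)).submatrix (stateperm n σ) id := by
  ext p q
  simp [bigB, stateperm]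

theorem bigK_relabel (Θ : Matrix (Fin n) (Fin n) ℝ) (k : Fin N) :
    bigK N Θ k = (bigK N Θ (σ k)).submatrix id (stateperm n σ) := by
  ext p q
  simp [bigK, stateperm, Matrix.one_apply]

theorem bigQ_relabel (k : Fin N) :
    g.bigQ N k = (g.bigQ N (σ k)).submatrix (stateperm n σ) (stateperm n σ) := by
  rw [bigQ, bigK_relabel σ]
  simp only [transpose_submatrix, submatrix_id_mul]
  rfl

theorem bigQf_relabel (k : Fin N) :
    g.bigQf N k = (g.bigQf N (σ k)).submatrix (stateperm n σ) (stateperm n σ) := by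
  rw [bigQf, bigK_relabel σ]
  simp only [transpose_submatrix, submatrix_id_mul]
  rfl

variable (P : Fin N → Matrix (Fin N × Fin n) (Fin N × Fin n) ℝ)

theorem bigR_relabel (k : Fin N) : g.bigR (relabel σ P) k = g.bigR P (σ k) := by
  rw [bigR, relabel, g.bigB_relabel σ]
  simp only [transpose_submatrix, submatrix_mul_equiv]
  rfl

theorem bigS_relabel (k : Fin N) : g.bigS (relabel σ P) k = g.bigS P (σ k) := by
  rw [bigS, relabel, g.bigB₀_relabel σ]
  simp only [transpose_submatrix, submatrix_mul_equiv]
  rfl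

theorem bigI_relabel : g.bigI (relabel σ P) = g.bigI P := by
  simp only [bigI, bigR_relabel, bigS_relabel]
  rw [Equiv.sum_comp σ fun k => (g.bigR P k)⁻¹ * g.bigS P k]

theorem bigBhat_transpose_mul_relabel (k l : Fin N) :
    (g.bigBhat N k)ᵀ * relabel σ P l =
      ((g.bigBhat N (σ k))ᵀ * P (σ l)).submatrix id (stateperm n σ) := by
  rw [relabel, g.bigBhat_relabel σ]
  simp only [transpose_submatrix, submatrix_mul_equiv]

theorem bigM₀_relabel : g.bigM₀ (relabel σ P) = (g.bigM₀ P).submatrix id (stateperm n σ) := by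
  have h : ∀ k, (g.bigR (relabel σ P) k)⁻¹ * (g.bigBhat N k)ᵀ * relabel σ P k =
      ((g.bigR P (σ k))⁻¹ * (g.bigBhat N (σ k))ᵀ * P (σ k)).submatrix id (stateperm n σ) := by
    intro k
    rw [Matrix.mul_assoc, bigBhat_transpose_mul_relabel, bigR_relabel, mul_submatrix_id,
      Matrix.mul_assoc]
  have hsum : ∑ k, ((g.bigR P (σ k))⁻¹ * (g.bigBhat N (σ k))ᵀ * P (σ k)).submatrix id
      (stateperm n σ) =
      (∑ k, (g.bigR P k)⁻¹ * (g.bigBhat N k)ᵀ * P k).submatrix id (stateperm n σ) := by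
    rw [Equiv.sum_comp σ fun k =>
      ((g.bigR P k)⁻¹ * (g.bigBhat N k)ᵀ * P k).submatrix id (stateperm n σ)]
    ext
    simp [Matrix.sum_apply]
  simp only [bigM₀, bigI_relabel, h, hsum, mul_submatrix_id, submatrix_neg, Pi.neg_apply]

theorem bigU_relabel (k : Fin N) :
    g.bigU (relabel σ P) k = (g.bigU P (σ k)).submatrix id (stateperm n σ) := by
  rw [bigU, bigS_relabel, bigM₀_relabel, bigBhat_transpose_mul_relabel, mul_submatrix_id]
  rfl

theorem sum_erase_submatrix {a b c d : Type*} (F : Fin N → Matrix a b ℝ) (f : c → a) (f' : d → b)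
    (i : Fin N) :
    ∑ k ∈ Finset.univ.erase i, (F (σ k)).submatrix f f' =
      (∑ k ∈ Finset.univ.erase (σ i), F k).submatrix f f' := by
  ext x y
  simp only [Matrix.sum_apply, submatrix_apply]
  exact Finset.sum_equiv σ (by simp) (by simp)

/-- Every ingredient is equivariant under relabelling; the sums over the players other than i become
sums over those other than σ i. -/
theorem bigPhi_relabel (i : Fin N) :
    g.bigPhi (relabel σ P) i = relabel σ (g.bigPhi P) i := by
  have hP : ∀ k, relabel σ P k = (P (σ k)).submatrix (stateperm n σ) (stateperm n σ) :=
    fun _ => rfl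
  simp only [bigPhi, bigR_relabel, bigS_relabel, bigM₀_relabel, bigU_relabel, hP]
  rw [g.bigA_relabel σ, g.bigQ_relabel σ]
  -- The opaque copies X and Y stop `simp` from applying the relabelling identities repeatedly to
  -- their own right-hand sides.
  obtain ⟨X, hX⟩ : ∃ X, X = g.bigBhat N := ⟨_, rfl⟩
  obtain ⟨Y, hY⟩ : ∃ Y, Y = g.bigB N := ⟨_, rfl⟩
  have hX' : ∀ k, g.bigBhat N k = (X (σ k)).submatrix (stateperm n σ) id := fun k =>
    hX ▸ g.bigBhat_relabel σ k
  have hY' : ∀ k, g.bigB N k = (Y (σ k)).submatrix (stateperm n σ) id := fun k =>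
    hY ▸ g.bigB_relabel σ k
  simp only [hX', hY', transpose_submatrix,
    submatrix_mul_equiv, submatrix_id_mul, mul_submatrix_id, submatrix_id_id,
    submatrix_submatrix, Function.comp_id, Function.id_comp]
  rw [sum_erase_submatrix σ (fun k => X k * (g.bigR P k)⁻¹ * g.bigU P k),
    sum_erase_submatrix σ
      (fun k => (g.bigU P k)ᵀ * (g.bigR P k)⁻¹ * (X k)ᵀ * P (σ i)),
    sum_erase_submatrix σ (fun k => (g.bigU P k)ᵀ * (g.bigR P k)⁻¹ *
        ((Y k)ᵀ * P (σ i) * Y k) * (g.bigR P k)⁻¹ * g.bigU P k)]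
  subst hX hY
  simp only [submatrix_mul_equiv]
  rfl

end Permutation

section Uniqueness

open scoped Matrix.Norms.Frobenius

theorem bigPhi_contDiffAt {P : Fin N → Matrix (Fin N × Fin n) (Fin N × Fin n) ℝ}
    (hR : ∀ k, IsUnit (g.bigR P k)) (hI : IsUnit (g.bigI P)) (i : Fin N) :
    ContDiffAt ℝ 1 (fun X => g.bigPhi X i) P := by
  have hH : ∀ k, ContDiffAt ℝ 1 (fun X => (g.bigR X k)⁻¹) P := fun k => by
    refine ContDiffAt.matrix_inv ?_ (hR k)
    unfold bigR
    fun_prop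
  have hS : ∀ k, ContDiffAt ℝ 1 (fun X => g.bigS X k) P := fun k => by
    unfold bigS
    fun_prop
  have hI' : ContDiffAt ℝ 1 (fun X => (g.bigI X)⁻¹) P := by
    refine ContDiffAt.matrix_inv ?_ hI
    unfold bigI
    fun_prop
  have hM : ContDiffAt ℝ 1 (fun X => g.bigM₀ X) P := by
    unfold bigM₀
    fun_prop
  have hU : ∀ k, ContDiffAt ℝ 1 (fun X => g.bigU X k) P := fun k => by
    unfold bigU
    fun_prop
  unfold bigPhi
  fun_prop

variable {g} in
/-- Solutions of the large Riccati system are exchangeable. -/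
theorem IsRiccatiSolution.relabel_eq {P : Fin N → ℝ → Matrix (Fin N × Fin n) (Fin N × Fin n) ℝ}
    (h : g.IsRiccatiSolution N P) (σ : Equiv.Perm (Fin N)) {t : ℝ}
    (ht : t ∈ Icc 0 g.T) : relabel σ (fun k => P k t) = fun k => P k t := by
  have key : EqOn (fun t => relabel σ (fun k => P k t)) (fun t k => P k t) (Icc 0 g.T) := by
    -- The relabelled tuple solves the same terminal value problem, and the constraints make the
    -- field C¹ along both trajectories.
    refine eqOn_Icc_of_hasDerivWithinAt_of_contDiffAt (v := fun X i => -g.bigPhi X i) ?_ ?_ ?_ ?_ ?_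
    · intro t ht
      refine hasDerivWithinAt_pi.2 fun i => hasDerivWithinAt_matrix.2 fun p q => ?_
      rw [bigPhi_relabel]
      exact hasDerivWithinAt_matrix.1 (h.deriv (σ i) t ht) (stateperm n σ p) (stateperm n σ q)
    · intro t ht
      exact hasDerivWithinAt_pi.2 fun i => h.deriv i t ht
    · intro t ht
      refine contDiffAt_pi.2 fun i => (g.bigPhi_contDiffAt (fun k => ?_) ?_ i).neg
      · rw [bigR_relabel]
        exact (h.posDef (σ k) t ht).isUnit
      · rw [bigI_relabel]
        exact h.isUnit t ht
    · intro t ht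
      exact contDiffAt_pi.2 fun i =>
        (g.bigPhi_contDiffAt (fun k => (h.posDef k t ht).isUnit) (h.isUnit t ht) i).neg
    · funext i
      simp only [relabel, h.terminal]
      exact (g.bigQf_relabel σ i).symm
  exact key ht

end Uniqueness

end LQGame

/-! ### Block decomposition of the large system -/

namespace LQGame

variable {n m : ℕ} (g : LQGame n m)

section Blocks

variable {N : ℕ} {a b : Type*}

theorem submatrix_mul_eq_sum_blocks {c d : Type*} (X : Matrix a (Fin N × Fin n) ℝ)
    (Y : Matrix (Fin N × Fin n) b ℝ) (f : c → a) (f' : d → b) :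
    (X * Y).submatrix f f' =
      ∑ k, X.submatrix f (Prod.mk k) * Y.submatrix (Prod.mk k) f' := by
  ext p q
  simp [mul_apply, Matrix.sum_apply, Fintype.sum_prod_type]

theorem bigBhat_transpose_mul (k : Fin N) (X : Matrix (Fin N × Fin n) b ℝ) :
    (g.bigBhat N k)ᵀ * X = g.Bᵀ * X.submatrix (Prod.mk k) id := by
  ext p q
  simp [bigBhat, mul_apply, Fintype.sum_prod_type, Finset.sum_ite_irrel]

theorem mul_bigBhat (k : Fin N) (X : Matrix a (Fin N × Fin n) ℝ) :
    X * g.bigBhat N k = X.submatrix id (Prod.mk k) * g.B := by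
  ext p q
  simp [bigBhat, mul_apply, Fintype.sum_prod_type, Finset.sum_ite_irrel]

theorem bigB_transpose_mul_mul (k : Fin N) (X : Matrix (Fin N × Fin n) (Fin N × Fin n) ℝ) :
    (g.bigB N k)ᵀ * X * g.bigB N k = g.B₁ᵀ * X.submatrix (Prod.mk k) (Prod.mk k) * g.B₁ := by
  ext p q
  simp [bigB, mul_apply, Fintype.sum_prod_type, Finset.sum_ite_irrel]

theorem bigB₀_transpose_mul_mul (X : Matrix (Fin N × Fin n) (Fin N × Fin n) ℝ) :
    (g.bigB₀ N)ᵀ * X * g.bigB₀ N =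
      ((N : ℝ)⁻¹ ^ 2) • (g.B₀ᵀ * (∑ j, ∑ l, X.submatrix (Prod.mk j) (Prod.mk l)) * g.B₀) := by
  have h : ∀ j : Fin N, (g.bigB₀ N).submatrix (Prod.mk j) id = (N : ℝ)⁻¹ • g.B₀ := fun j => by
    ext p q
    simp [bigB₀, div_eq_inv_mul]
  rw [Matrix.mul_assoc, ← submatrix_id_id ((g.bigB₀ N)ᵀ * (X * g.bigB₀ N)),
    submatrix_mul_eq_sum_blocks]
  simp only [submatrix_mul_eq_sum_blocks, ← transpose_submatrix, h, Matrix.mul_sum,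
    Matrix.sum_mul, Finset.smul_sum, transpose_smul, Matrix.smul_mul, Matrix.mul_smul, smul_smul,
    Matrix.mul_assoc, sq]

theorem mul_bigA_submatrix (X : Matrix a (Fin N × Fin n) ℝ) (l : Fin N) :
    (X * g.bigA N).submatrix id (Prod.mk l) =
      X.submatrix id (Prod.mk l) * g.A +
        (N : ℝ)⁻¹ • ((∑ k, X.submatrix id (Prod.mk k)) * g.G) := by
  have h : ∀ k : Fin N, (g.bigA N).submatrix (Prod.mk k) (Prod.mk l) =
      (if k = l then g.A else 0) + (N : ℝ)⁻¹ • g.G := fun k => by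
    ext p q
    by_cases hk : k = l <;> simp [bigA, div_eq_inv_mul, hk]
  simp only [submatrix_mul_eq_sum_blocks, h, Matrix.mul_add, Finset.sum_add_distrib, Matrix.mul_smul,
    Matrix.sum_mul, Finset.smul_sum]
  rw [Finset.sum_eq_single l (fun k _ hk => by simp [hk]) (by simp), if_pos rfl]

theorem bigA_transpose_mul_submatrix (X : Matrix (Fin N × Fin n) b ℝ) (j : Fin N) :
    ((g.bigA N)ᵀ * X).submatrix (Prod.mk j) id =
      g.Aᵀ * X.submatrix (Prod.mk j) id +
        (N : ℝ)⁻¹ • (g.Gᵀ * ∑ k, X.submatrix (Prod.mk k) id) := by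
  have h := congrArg transpose (g.mul_bigA_submatrix Xᵀ j)
  simpa [transpose_sum, transpose_submatrix] using h

/-- The blocks of the right-hand side of the large Riccati system, when all players have the same
`𝐑ₖ⁻¹ = H` and `𝐒ₖ = S` and all blocks of `𝐌₀` coincide. -/
theorem bigPhi_submatrix {P : Fin N → Matrix (Fin N × Fin n) (Fin N × Fin n) ℝ}
    {H S : Matrix (Fin m) (Fin m) ℝ} {M : Matrix (Fin m) (Fin n) ℝ}
    {U : Fin N → Fin N → Matrix (Fin m) (Fin n) ℝ} (hH : ∀ k, (g.bigR P k)⁻¹ = H)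
    (hS : ∀ k, g.bigS P k = S) (hM : ∀ j, (g.bigM₀ P).submatrix id (Prod.mk j) = M)
    (hU : ∀ k j, (g.bigU P k).submatrix id (Prod.mk j) = U k j)
    {p : Fin N → Fin N → Matrix (Fin n) (Fin n) ℝ} {i : Fin N}
    (hp : ∀ j l, (P i).submatrix (Prod.mk j) (Prod.mk l) = p j l) (j l : Fin N) :
    (g.bigPhi P i).submatrix (Prod.mk j) (Prod.mk l) =
      p j l * g.A + (N : ℝ)⁻¹ • ((∑ k, p j k) * g.G)
        + (g.Aᵀ * p j l + (N : ℝ)⁻¹ • (g.Gᵀ * ∑ k, p k l))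
        + (g.bigQ N i).submatrix (Prod.mk j) (Prod.mk l)
        - p j i * g.B * H * g.Bᵀ * p i l
        + Mᵀ * S * H * S * M
        - ∑ k ∈ Finset.univ.erase i, p j k * g.B * H * U k l
        - ∑ k ∈ Finset.univ.erase i, (U k j)ᵀ * H * g.Bᵀ * p k l
        + ∑ k ∈ Finset.univ.erase i, (U k j)ᵀ * H * (g.B₁ᵀ * p k k * g.B₁) * H * U k l
        + Mᵀ * S * M := by
  obtain rfl : p = fun j l => (P i).submatrix (Prod.mk j) (Prod.mk l) := by
    funext j l
    exact (hp j l).symm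
  obtain rfl : U = fun k j => (g.bigU P k).submatrix id (Prod.mk j) := by
    funext k j
    exact (hU k j).symm
  have hA₁ : (P i * g.bigA N).submatrix (Prod.mk j) (Prod.mk l) =
      (P i).submatrix (Prod.mk j) (Prod.mk l) * g.A +
        (N : ℝ)⁻¹ • ((∑ k, (P i).submatrix (Prod.mk j) (Prod.mk k)) * g.G) := by
    have h := congrArg (fun X => X.submatrix (Prod.mk j) id) (g.mul_bigA_submatrix (P i) l)
    refine h.trans ?_
    ext
    simp [mul_apply, Matrix.sum_apply]
  have hA₂ : ((g.bigA N)ᵀ * P i).submatrix (Prod.mk j) (Prod.mk l) =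
      g.Aᵀ * (P i).submatrix (Prod.mk j) (Prod.mk l) +
        (N : ℝ)⁻¹ • (g.Gᵀ * ∑ k, (P i).submatrix (Prod.mk k) (Prod.mk l)) := by
    have h := congrArg (fun X => X.submatrix id (Prod.mk l))
      (g.bigA_transpose_mul_submatrix (P i) j)
    refine h.trans ?_
    ext
    simp [mul_apply, Matrix.sum_apply]
  have hsum : ∀ (F : Fin N → Matrix (Fin N × Fin n) (Fin N × Fin n) ℝ),
      (∑ k ∈ Finset.univ.erase i, F k).submatrix (Prod.mk j) (Prod.mk l) =
        ∑ k ∈ Finset.univ.erase i, (F k).submatrix (Prod.mk j) (Prod.mk l) := fun F => by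
    ext
    simp [Matrix.sum_apply]
  have hM₁ : ((g.bigM₀ P)ᵀ * S * H * S * g.bigM₀ P).submatrix (Prod.mk j) (Prod.mk l) =
      Mᵀ * S * H * S * M := by
    calc _ = ((g.bigM₀ P).submatrix id (Prod.mk j))ᵀ * S * H * S *
          (g.bigM₀ P).submatrix id (Prod.mk l) := rfl
      _ = _ := by rw [hM, hM]
  have hM₂ : ((g.bigM₀ P)ᵀ * S * g.bigM₀ P).submatrix (Prod.mk j) (Prod.mk l) = Mᵀ * S * M := by
    calc _ = ((g.bigM₀ P).submatrix id (Prod.mk j))ᵀ * S *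
          (g.bigM₀ P).submatrix id (Prod.mk l) := rfl
      _ = _ := by rw [hM, hM]
  have hB₁ : ∀ (k : Fin N) (X : Matrix (Fin m) (Fin N × Fin n) ℝ),
      (P i * (g.bigBhat N k * H * X)).submatrix (Prod.mk j) (Prod.mk l) =
        (P i).submatrix (Prod.mk j) (Prod.mk k) * g.B * H * X.submatrix id (Prod.mk l) := by
    intro k X
    rw [← Matrix.mul_assoc, ← Matrix.mul_assoc, mul_bigBhat]
    rfl
  have hB₂ : ∀ (k : Fin N) (X : Matrix (Fin N × Fin n) (Fin m) ℝ),
      (X * H * (g.bigBhat N k)ᵀ * P i).submatrix (Prod.mk j) (Prod.mk l) =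
        X.submatrix (Prod.mk j) id * H * g.Bᵀ * (P i).submatrix (Prod.mk k) (Prod.mk l) := by
    intro k X
    rw [Matrix.mul_assoc, bigBhat_transpose_mul, Matrix.mul_assoc (_ * H)]
    rfl
  have hB₃ : (P i * g.bigBhat N i).submatrix (Prod.mk j) id =
      (P i).submatrix (Prod.mk j) (Prod.mk i) * g.B := by
    rw [mul_bigBhat]
    rfl
  have hB₄ : ∀ (X : Matrix (Fin N × Fin n) (Fin m) ℝ) (Y : Matrix (Fin m) (Fin m) ℝ)
      (Z : Matrix (Fin m) (Fin N × Fin n) ℝ),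
      (X * H * Y * H * Z).submatrix (Prod.mk j) (Prod.mk l) =
        X.submatrix (Prod.mk j) id * H * Y * H * Z.submatrix id (Prod.mk l) := fun X Y Z => rfl
  simp only [bigPhi, submatrix_add, submatrix_sub, Pi.add_apply, Pi.sub_apply, hA₁, hA₂, hH, hS,
    Matrix.mul_sum, hsum, bigB_transpose_mul_mul, hM₁, hM₂, hB₁, hB₂, hB₃, hB₄,
    transpose_submatrix]

end Blocks

end LQGame

/-! ### Sums over players with few exceptional terms -/

section ConstantSums

variable {N : ℕ} {V : Type*} [AddCommGroup V] [Module ℝ V]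

/-- For an exchangeable tuple, the summand over the players takes a single value away from the row,
the column and the distinguished player; at most three indices are exceptional. -/
theorem sum_sdiff_eq_smul {f : Fin N → V} {s : Finset (Fin N)} {v : V} (h : ∀ k ∉ s, f k = v) :
    ∑ k ∈ Finset.univ \ s, f k = ((N : ℝ) - s.card) • v := by
  rw [Finset.sum_congr rfl fun k hk => h k (by simpa using hk), Finset.sum_const,
    Finset.card_sdiff_of_subset (Finset.subset_univ s), Finset.card_univ, Fintype.card_fin,
    ← Nat.cast_smul_eq_nsmul ℝ, Nat.cast_sub (by simpa using Finset.card_le_univ s)]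

theorem sum_erase_eq_smul {f : Fin N → V} {i : Fin N} {v : V} (h : ∀ k, k ≠ i → f k = v) :
    ∑ k ∈ Finset.univ.erase i, f k = ((N : ℝ) - 1) • v := by
  simpa [Finset.sdiff_singleton_eq_erase] using
    sum_sdiff_eq_smul (s := {i}) fun k hk => h k (by simpa using hk)

theorem sum_eq_add_smul {f : Fin N → V} {i : Fin N} {v : V} (h : ∀ k, k ≠ i → f k = v) :
    ∑ k, f k = f i + ((N : ℝ) - 1) • v := by
  rw [← Finset.add_sum_erase _ _ (Finset.mem_univ i), sum_erase_eq_smul h]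

theorem sum_erase_eq_add_smul {f : Fin N → V} {i j : Fin N} (hij : j ≠ i) {v : V}
    (h : ∀ k, k ≠ i → k ≠ j → f k = v) :
    ∑ k ∈ Finset.univ.erase i, f k = f j + ((N : ℝ) - 2) • v := by
  have h1 := sum_sdiff_eq_smul (f := f) (s := {i, j}) (v := v) fun k hk => by
    simp only [Finset.mem_insert, Finset.mem_singleton, not_or] at hk
    exact h k hk.1 hk.2
  rw [Finset.card_pair hij.symm] at h1
  rw [← Finset.add_sum_erase _ _ (Finset.mem_erase.2 ⟨hij, Finset.mem_univ j⟩)]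
  have h2 : (Finset.univ.erase i).erase j = Finset.univ \ {i, j} := by
    ext k
    simp [and_comm]
  rw [h2, h1]
  norm_num

theorem sum_erase_eq_add_add_smul {f : Fin N → V} {i j l : Fin N} (hij : j ≠ i) (hil : l ≠ i)
    (hjl : j ≠ l) {v : V} (h : ∀ k, k ≠ i → k ≠ j → k ≠ l → f k = v) :
    ∑ k ∈ Finset.univ.erase i, f k = f j + f l + ((N : ℝ) - 3) • v := by
  have h1 := sum_sdiff_eq_smul (f := f) (s := {i, j, l}) (v := v) fun k hk => by
    simp only [Finset.mem_insert, Finset.mem_singleton, not_or] at hk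
    exact h k hk.1 hk.2.1 hk.2.2
  rw [Finset.card_eq_three.2 ⟨i, j, l, hij.symm, hil.symm, hjl, rfl⟩] at h1
  rw [← Finset.add_sum_erase _ _ (Finset.mem_erase.2 ⟨hij, Finset.mem_univ j⟩),
    ← Finset.add_sum_erase _ _ (Finset.mem_erase.2 ⟨hjl.symm, Finset.mem_erase.2
      ⟨hil, Finset.mem_univ l⟩⟩)]
  have h2 : ((Finset.univ.erase i).erase j).erase l = Finset.univ \ {i, j, l} := by
    ext k
    simp only [Finset.mem_erase, Finset.mem_univ, and_true, Finset.mem_sdiff, true_and,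
      Finset.mem_insert, Finset.mem_singleton, not_or]
    tauto
  rw [h2, h1, add_assoc]
  norm_num

end ConstantSums

/-! ### Exchangeable tuples and the reduced four-block system -/

namespace LQGame

/-- The four matrices `(Λ₁, Λ₂, Λ₃, Λ₄)` that describe an exchangeable tuple of `Nn × Nn`
matrices. -/
abbrev Quad (n : ℕ) : Type :=
  Matrix (Fin n) (Fin n) ℝ × Matrix (Fin n) (Fin n) ℝ × Matrix (Fin n) (Fin n) ℝ ×
    Matrix (Fin n) (Fin n) ℝ

variable {n m : ℕ} (g : LQGame n m)

section Exchangeable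

variable {N : ℕ} (x : Quad n)

/-- The `(j, l)` block of the `i`-th matrix of the exchangeable tuple described by `x`. -/
noncomputable def exchBlock (i j l : Fin N) : Matrix (Fin n) (Fin n) ℝ :=
  if j = i then if l = i then x.1 else (N : ℝ)⁻¹ • x.2.1
  else if l = i then (N : ℝ)⁻¹ • x.2.1ᵀ
  else if j = l then ((N : ℝ)⁻¹ ^ 2) • x.2.2.1 else ((N : ℝ)⁻¹ ^ 2) • x.2.2.2

/-- The exchangeable tuple of `Nn × Nn` matrices with the rescaled blocks `x`. -/
noncomputable def exch (i : Fin N) : Matrix (Fin N × Fin n) (Fin N × Fin n) ℝ :=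
  Matrix.of fun p q => exchBlock x i p.1 q.1 p.2 q.2

theorem exch_submatrix (i j l : Fin N) :
    (exch x i).submatrix (Prod.mk j) (Prod.mk l) = exchBlock x i j l := rfl

theorem exchBlock_self (i : Fin N) : exchBlock x i i i = x.1 := by simp [exchBlock]

variable {i j l : Fin N}

theorem exchBlock_left (hl : l ≠ i) : exchBlock x i i l = (N : ℝ)⁻¹ • x.2.1 := by
  simp [exchBlock, hl]

theorem exchBlock_right (hj : j ≠ i) : exchBlock x i j i = (N : ℝ)⁻¹ • x.2.1ᵀ := by
  simp [exchBlock, hj]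

theorem exchBlock_diag (hj : j ≠ i) : exchBlock x i j j = ((N : ℝ)⁻¹ ^ 2) • x.2.2.1 := by
  simp [exchBlock, hj]

theorem exchBlock_off (hj : j ≠ i) (hl : l ≠ i) (hjl : j ≠ l) :
    exchBlock x i j l = ((N : ℝ)⁻¹ ^ 2) • x.2.2.2 := by
  simp [exchBlock, hj, hl, hjl]

end Exchangeable

section ReducedField

variable (h : ℝ) (x : Quad n)

/-- `N²` times the sum of all blocks of an exchangeable matrix, conjugated by `B₀`; here and below
`h` stands for `1 / N`. -/
noncomputable def redS : Matrix (Fin m) (Fin m) ℝ :=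
  g.B₀ᵀ * (x.1 + (1 - h) • (x.2.1 + x.2.1ᵀ) + (h * (1 - h)) • x.2.2.1
    + ((1 - h) * (1 - 2 * h)) • x.2.2.2) * g.B₀

/-- The matrix `𝐈₀` of an exchangeable tuple. -/
noncomputable def redI : Matrix (Fin m) (Fin m) ℝ :=
  1 + h • ((g.R₁ x.1)⁻¹ * g.redS h x)

/-- The common block of `𝐌₀` of an exchangeable tuple. -/
noncomputable def redM : Matrix (Fin m) (Fin n) ℝ :=
  -((g.redI h x)⁻¹ * ((g.R₁ x.1)⁻¹ * g.Bᵀ * (x.1 + (1 - h) • x.2.1)))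

/-- The `k`-th block of `𝐔ₖ` of an exchangeable tuple. -/
noncomputable def redU : Matrix (Fin m) (Fin n) ℝ :=
  g.Bᵀ * x.1 + h ^ 2 • (g.redS h x * g.redM h x)

/-- `N` times the other blocks of `𝐔ₖ` of an exchangeable tuple. -/
noncomputable def redW : Matrix (Fin m) (Fin n) ℝ :=
  g.Bᵀ * x.2.1 + h • (g.redS h x * g.redM h x)

/-- `N²` times the quadratic form that weighs the controls of the other players. -/
noncomputable def redX : Matrix (Fin m) (Fin m) ℝ :=
  (g.R₁ x.1)⁻¹ * (g.B₁ᵀ * x.2.2.1 * g.B₁) * (g.R₁ x.1)⁻¹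

/-- The rescaled `(1, 1)` block of the right-hand side of the large Riccati system. -/
noncomputable def redPhi₁ : Matrix (Fin n) (Fin n) ℝ :=
  x.1 * g.A + h • ((x.1 + (1 - h) • x.2.1) * g.G)
    + (g.Aᵀ * x.1 + h • (g.Gᵀ * (x.1 + (1 - h) • x.2.1ᵀ)))
    + (1 - h • g.Γ)ᵀ * g.Q * (1 - h • g.Γ)
    - x.1 * g.B * (g.R₁ x.1)⁻¹ * g.Bᵀ * x.1
    + h ^ 4 • ((g.redM h x)ᵀ * g.redS h x * (g.R₁ x.1)⁻¹ * g.redS h x * g.redM h x)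
    - (h * (1 - h)) • (x.2.1 * g.B * (g.R₁ x.1)⁻¹ * g.redW h x)
    - (h * (1 - h)) • ((g.redW h x)ᵀ * (g.R₁ x.1)⁻¹ * g.Bᵀ * x.2.1ᵀ)
    + (h ^ 3 * (1 - h)) • ((g.redW h x)ᵀ * g.redX x * g.redW h x)
    + h ^ 2 • ((g.redM h x)ᵀ * g.redS h x * g.redM h x)

/-- The rescaled `(1, 2)` block of the right-hand side of the large Riccati system. -/
noncomputable def redPhi₂ : Matrix (Fin n) (Fin n) ℝ :=
  x.2.1 * g.A + (x.1 + (1 - h) • x.2.1) * g.G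
    + (g.Aᵀ * x.2.1 + h • (g.Gᵀ * (x.2.1 + h • x.2.2.1 + (1 - 2 * h) • x.2.2.2)))
    - (1 - h • g.Γ)ᵀ * g.Q * g.Γ
    - x.1 * g.B * (g.R₁ x.1)⁻¹ * g.Bᵀ * x.2.1
    + h ^ 3 • ((g.redM h x)ᵀ * g.redS h x * (g.R₁ x.1)⁻¹ * g.redS h x * g.redM h x)
    - x.2.1 * g.B * (g.R₁ x.1)⁻¹ * (g.redU h x + (1 - 2 * h) • g.redW h x)
    - h • ((g.redW h x)ᵀ * (g.R₁ x.1)⁻¹ * g.Bᵀ * (h • x.2.2.1 + (1 - 2 * h) • x.2.2.2))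
    + h ^ 2 • ((g.redW h x)ᵀ * g.redX x * (g.redU h x + (1 - 2 * h) • g.redW h x))
    + h • ((g.redM h x)ᵀ * g.redS h x * g.redM h x)

/-- The part that the rescaled `(2, 2)` and `(2, 3)` blocks of the right-hand side of the large
Riccati system have in common. -/
noncomputable def redPhiCommon : Matrix (Fin n) (Fin n) ℝ :=
  (x.2.1ᵀ + h • x.2.2.1 + (1 - 2 * h) • x.2.2.2) * g.G
    + g.Gᵀ * (x.2.1 + h • x.2.2.1 + (1 - 2 * h) • x.2.2.2)
    + g.Γᵀ * g.Q * g.Γ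
    - x.2.1ᵀ * g.B * (g.R₁ x.1)⁻¹ * g.Bᵀ * x.2.1
    + h ^ 2 • ((g.redM h x)ᵀ * g.redS h x * (g.R₁ x.1)⁻¹ * g.redS h x * g.redM h x)
    + (g.redM h x)ᵀ * g.redS h x * g.redM h x

/-- The rescaled `(2, 2)` block of the right-hand side of the large Riccati system. -/
noncomputable def redPhi₃ : Matrix (Fin n) (Fin n) ℝ :=
  x.2.2.1 * g.A + g.Aᵀ * x.2.2.1 + g.redPhiCommon h x
    - (x.2.2.1 * g.B * (g.R₁ x.1)⁻¹ * g.redU h x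
      + (1 - 2 * h) • (x.2.2.2 * g.B * (g.R₁ x.1)⁻¹ * g.redW h x))
    - ((g.redU h x)ᵀ * (g.R₁ x.1)⁻¹ * g.Bᵀ * x.2.2.1
      + (1 - 2 * h) • ((g.redW h x)ᵀ * (g.R₁ x.1)⁻¹ * g.Bᵀ * x.2.2.2))
    + ((g.redU h x)ᵀ * g.redX x * g.redU h x
      + (h * (1 - 2 * h)) • ((g.redW h x)ᵀ * g.redX x * g.redW h x))

/-- The rescaled `(2, 3)` block of the right-hand side of the large Riccati system. -/
noncomputable def redPhi₄ : Matrix (Fin n) (Fin n) ℝ :=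
  x.2.2.2 * g.A + g.Aᵀ * x.2.2.2 + g.redPhiCommon h x
    - (h • (x.2.2.1 * g.B * (g.R₁ x.1)⁻¹ * g.redW h x)
      + x.2.2.2 * g.B * (g.R₁ x.1)⁻¹ * g.redU h x
      + (1 - 3 * h) • (x.2.2.2 * g.B * (g.R₁ x.1)⁻¹ * g.redW h x))
    - ((g.redU h x)ᵀ * (g.R₁ x.1)⁻¹ * g.Bᵀ * x.2.2.2
      + h • ((g.redW h x)ᵀ * (g.R₁ x.1)⁻¹ * g.Bᵀ * x.2.2.1)
      + (1 - 3 * h) • ((g.redW h x)ᵀ * (g.R₁ x.1)⁻¹ * g.Bᵀ * x.2.2.2))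
    + h • ((g.redU h x)ᵀ * g.redX x * g.redW h x + (g.redW h x)ᵀ * g.redX x * g.redU h x
      + (1 - 3 * h) • ((g.redW h x)ᵀ * g.redX x * g.redW h x))

end ReducedField

/-! ### Evaluation of the large system on exchangeable tuples -/

section Reduction

variable {N : ℕ} (x : Quad n)

theorem bigR_exch (k : Fin N) : g.bigR (exch x) k = g.R₁ x.1 := by
  rw [bigR, bigB_transpose_mul_mul, exch_submatrix, exchBlock_self, R₁]

theorem sum_exchBlock_left (i : Fin N) :
    ∑ k, exchBlock x i i k = x.1 + (1 - (N : ℝ)⁻¹) • x.2.1 := by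
  have hN : (N : ℝ) ≠ 0 := Nat.cast_ne_zero.2 (i.pos).ne'
  rw [sum_eq_add_smul fun k hk => exchBlock_left x hk, exchBlock_self, smul_smul, sub_mul,
    mul_inv_cancel₀ hN, one_mul]

theorem sum_exchBlock_right (i : Fin N) :
    ∑ k, exchBlock x i k i = x.1 + (1 - (N : ℝ)⁻¹) • x.2.1ᵀ := by
  have hN : (N : ℝ) ≠ 0 := Nat.cast_ne_zero.2 (i.pos).ne'
  rw [sum_eq_add_smul fun k hk => exchBlock_right x hk, exchBlock_self, smul_smul, sub_mul,
    mul_inv_cancel₀ hN, one_mul]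

theorem sum_exchBlock_row {i j : Fin N} (hj : j ≠ i) :
    ∑ k, exchBlock x i j k = (N : ℝ)⁻¹ •
      (x.2.1ᵀ + (N : ℝ)⁻¹ • x.2.2.1 + (1 - 2 * (N : ℝ)⁻¹) • x.2.2.2) := by
  have hN : (N : ℝ) ≠ 0 := Nat.cast_ne_zero.2 (i.pos).ne'
  rw [← Finset.add_sum_erase _ _ (Finset.mem_univ i), sum_erase_eq_add_smul hj
    fun k hki hkj => exchBlock_off x hj hki hkj.symm, exchBlock_right x hj, exchBlock_diag x hj]
  match_scalars <;> field_simp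

theorem sum_exchBlock_col {i l : Fin N} (hl : l ≠ i) :
    ∑ k, exchBlock x i k l = (N : ℝ)⁻¹ •
      (x.2.1 + (N : ℝ)⁻¹ • x.2.2.1 + (1 - 2 * (N : ℝ)⁻¹) • x.2.2.2) := by
  have hN : (N : ℝ) ≠ 0 := Nat.cast_ne_zero.2 (i.pos).ne'
  rw [← Finset.add_sum_erase _ _ (Finset.mem_univ i), sum_erase_eq_add_smul hl
    fun k hki hkl => exchBlock_off x hki hl hkl, exchBlock_left x hl, exchBlock_diag x hl]
  match_scalars <;> field_simp

/-- All blocks of 𝐁₀ equal B₀ / N, so 𝐒ₖ sees only the sum of all blocks. The N⁻² of the last two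
block types cancels against their number, so the sum stays of order one. -/
theorem bigS_exch (k : Fin N) : g.bigS (exch x) k = ((N : ℝ)⁻¹ ^ 2) • g.redS (N : ℝ)⁻¹ x := by
  have hN : (N : ℝ) ≠ 0 := Nat.cast_ne_zero.2 (k.pos).ne'
  rw [bigS, bigB₀_transpose_mul_mul, redS]
  simp only [exch_submatrix]
  congr 4
  rw [sum_eq_add_smul fun j hj => sum_exchBlock_row x hj, sum_exchBlock_left]
  match_scalars <;> field_simp

theorem bigI_exch (hN : N ≠ 0) : g.bigI (exch x : Fin N → _) = g.redI (N : ℝ)⁻¹ x := by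
  have hN : (N : ℝ) ≠ 0 := Nat.cast_ne_zero.2 hN
  simp only [bigI, bigR_exch, bigS_exch, redI, Finset.sum_const, Finset.card_univ,
    Fintype.card_fin, Matrix.mul_smul]
  rw [← Nat.cast_smul_eq_nsmul ℝ, smul_smul]
  congr 2
  field_simp

/-- Player k contributes the k-th row of its own matrix. In column j one contribution is the
diagonal block and N - 1 are of order 1/N, so the total does not depend on j. -/
theorem bigM₀_exch (j : Fin N) :
    (g.bigM₀ (exch x : Fin N → _)).submatrix id (Prod.mk j) = g.redM (N : ℝ)⁻¹ x := by
  have hsum : (∑ k, (g.bigR (exch x) k)⁻¹ * (g.bigBhat N k)ᵀ * exch x k).submatrix id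
      (Prod.mk j) = (g.R₁ x.1)⁻¹ * g.Bᵀ * ∑ k, exchBlock x k k j := by
    have h1 : ∀ k, ((g.bigR (exch x) k)⁻¹ * (g.bigBhat N k)ᵀ * exch x k).submatrix id
        (Prod.mk j) = (g.R₁ x.1)⁻¹ * g.Bᵀ * exchBlock x k k j := fun k => by
      rw [bigR_exch, Matrix.mul_assoc, bigBhat_transpose_mul, ← Matrix.mul_assoc]
      rfl
    rw [Matrix.mul_sum, ← Finset.sum_congr rfl fun k _ => h1 k]
    ext
    simp [Matrix.sum_apply]
  have hN : (N : ℝ) ≠ 0 := Nat.cast_ne_zero.2 (j.pos).ne'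
  have h2 : ∑ k, exchBlock x k k j = x.1 + (1 - (N : ℝ)⁻¹) • x.2.1 := by
    rw [sum_eq_add_smul fun k hk => exchBlock_left x (Ne.symm hk), exchBlock_self, smul_smul,
      sub_mul, mul_inv_cancel₀ hN, one_mul]
  rw [h2] at hsum
  rw [bigM₀, redM, ← hsum, bigI_exch _ _ (j.pos).ne', mul_submatrix_id]
  rfl

theorem bigU_exch (k j : Fin N) :
    (g.bigU (exch x : Fin N → _) k).submatrix id (Prod.mk j) =
      ((N : ℝ)⁻¹ ^ 2) • (g.redS (N : ℝ)⁻¹ x * g.redM (N : ℝ)⁻¹ x) + g.Bᵀ * exchBlock x k k j := by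
  rw [← Matrix.smul_mul, ← bigS_exch g x k, ← g.bigM₀_exch x j, bigU, bigBhat_transpose_mul]
  rfl

theorem bigU_exch_self (k : Fin N) :
    (g.bigU (exch x : Fin N → _) k).submatrix id (Prod.mk k) = g.redU (N : ℝ)⁻¹ x := by
  rw [bigU_exch, exchBlock_self, redU, add_comm]

theorem bigU_exch_ne {k j : Fin N} (hj : j ≠ k) :
    (g.bigU (exch x : Fin N → _) k).submatrix id (Prod.mk j) =
      (N : ℝ)⁻¹ • g.redW (N : ℝ)⁻¹ x := by
  rw [bigU_exch, exchBlock_left x hj, redW, Matrix.mul_smul, smul_add, smul_smul, add_comm, sq]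

/-- The blocks of `𝐔ₖ` of an exchangeable tuple. -/
noncomputable def exchU (k j : Fin N) : Matrix (Fin m) (Fin n) ℝ :=
  if j = k then g.redU (N : ℝ)⁻¹ x else (N : ℝ)⁻¹ • g.redW (N : ℝ)⁻¹ x

theorem exchU_self (k : Fin N) : g.exchU x k k = g.redU (N : ℝ)⁻¹ x := if_pos rfl

theorem exchU_ne {k j : Fin N} (h : j ≠ k) :
    g.exchU x k j = (N : ℝ)⁻¹ • g.redW (N : ℝ)⁻¹ x := if_neg h

theorem bigPhi_exch (i j l : Fin N) :
    (g.bigPhi (exch x) i).submatrix (Prod.mk j) (Prod.mk l) =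
      exchBlock x i j l * g.A + (N : ℝ)⁻¹ • ((∑ k, exchBlock x i j k) * g.G)
        + (g.Aᵀ * exchBlock x i j l + (N : ℝ)⁻¹ • (g.Gᵀ * ∑ k, exchBlock x i k l))
        + (g.bigQ N i).submatrix (Prod.mk j) (Prod.mk l)
        - exchBlock x i j i * g.B * (g.R₁ x.1)⁻¹ * g.Bᵀ * exchBlock x i i l
        + ((N : ℝ)⁻¹ ^ 4) • ((g.redM (N : ℝ)⁻¹ x)ᵀ * g.redS (N : ℝ)⁻¹ x * (g.R₁ x.1)⁻¹ *
            g.redS (N : ℝ)⁻¹ x * g.redM (N : ℝ)⁻¹ x)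
        - ∑ k ∈ Finset.univ.erase i, exchBlock x i j k * g.B * (g.R₁ x.1)⁻¹ * g.exchU x k l
        - ∑ k ∈ Finset.univ.erase i, (g.exchU x k j)ᵀ * (g.R₁ x.1)⁻¹ * g.Bᵀ * exchBlock x i k l
        + ((N : ℝ)⁻¹ ^ 2) •
            ∑ k ∈ Finset.univ.erase i, (g.exchU x k j)ᵀ * g.redX x * g.exchU x k l
        + ((N : ℝ)⁻¹ ^ 2) •
            ((g.redM (N : ℝ)⁻¹ x)ᵀ * g.redS (N : ℝ)⁻¹ x * g.redM (N : ℝ)⁻¹ x) := by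
  rw [g.bigPhi_submatrix (fun k => by rw [bigR_exch]) (g.bigS_exch x) (g.bigM₀_exch x)
    (U := g.exchU x) (fun k j => ?_) (fun j l => exch_submatrix x i j l)]
  · have hX : ∀ k ∈ Finset.univ.erase i, (g.exchU x k j)ᵀ * (g.R₁ x.1)⁻¹ *
        (g.B₁ᵀ * exchBlock x i k k * g.B₁) * (g.R₁ x.1)⁻¹ * g.exchU x k l =
        ((N : ℝ)⁻¹ ^ 2) • ((g.exchU x k j)ᵀ * g.redX x * g.exchU x k l) := fun k hk => by
      rw [exchBlock_diag x (Finset.ne_of_mem_erase hk), redX]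
      simp only [Matrix.mul_smul, Matrix.smul_mul, Matrix.mul_assoc]
    rw [Finset.sum_congr rfl hX, ← Finset.smul_sum]
    simp only [Matrix.mul_smul, Matrix.smul_mul, smul_smul]
    congr 4
    ring_nf
  · by_cases hj : j = k
    · rw [hj, exchU_self, bigU_exch_self]
    · rw [exchU_ne _ _ hj, bigU_exch_ne _ _ hj]

theorem bigK_conj_submatrix (Θ M : Matrix (Fin n) (Fin n) ℝ) (i j l : Fin N) :
    ((bigK N Θ i)ᵀ * M * bigK N Θ i).submatrix (Prod.mk j) (Prod.mk l) =
      ((if j = i then 1 else 0) - (N : ℝ)⁻¹ • Θ)ᵀ * M *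
        ((if l = i then 1 else 0) - (N : ℝ)⁻¹ • Θ) := by
  have hK : ∀ j, (bigK N Θ i).submatrix id (Prod.mk j) =
      (if j = i then 1 else 0) - (N : ℝ)⁻¹ • Θ := fun j => by
    ext p q
    by_cases hj : j = i <;> simp [bigK, hj, div_eq_inv_mul]
  rw [← hK, ← hK]
  rfl

theorem bigQ_submatrix (i j l : Fin N) :
    (g.bigQ N i).submatrix (Prod.mk j) (Prod.mk l) =
      ((if j = i then 1 else 0) - (N : ℝ)⁻¹ • g.Γ)ᵀ * g.Q *
        ((if l = i then 1 else 0) - (N : ℝ)⁻¹ • g.Γ) :=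
  bigK_conj_submatrix g.Γ g.Q i j l

theorem bigPhi_exch_self (i : Fin N) :
    (g.bigPhi (exch x) i).submatrix (Prod.mk i) (Prod.mk i) = g.redPhi₁ (N : ℝ)⁻¹ x := by
  have hN : (N : ℝ) ≠ 0 := Nat.cast_ne_zero.2 (i.pos).ne'
  rw [bigPhi_exch, bigQ_submatrix, if_pos rfl, exchBlock_self, sum_exchBlock_left,
    sum_exchBlock_right,
    sum_erase_eq_smul fun k hk => by rw [exchBlock_left x hk, exchU_ne _ _ hk.symm],
    sum_erase_eq_smul fun k hk => by rw [exchBlock_right x hk, exchU_ne _ _ hk.symm],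
    sum_erase_eq_smul fun k hk => by rw [exchU_ne _ _ hk.symm], redPhi₁]
  simp only [Matrix.mul_smul, Matrix.smul_mul, smul_smul, transpose_smul]
  match_scalars <;> field_simp

/-- The term k = l must be set apart: there the l-th block of 𝐔ₖ is `redU`, of order one, while for
each of the remaining N - 2 players it is of order 1/N. In the first sum both groups survive at h =
0. -/
theorem bigPhi_exch_left {i l : Fin N} (hl : l ≠ i) :
    (g.bigPhi (exch x) i).submatrix (Prod.mk i) (Prod.mk l) =
      (N : ℝ)⁻¹ • g.redPhi₂ (N : ℝ)⁻¹ x := by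
  have hN : (N : ℝ) ≠ 0 := Nat.cast_ne_zero.2 (i.pos).ne'
  rw [bigPhi_exch, bigQ_submatrix, if_pos rfl, if_neg hl, exchBlock_self, exchBlock_left x hl,
    sum_exchBlock_left, sum_exchBlock_col x hl,
    sum_erase_eq_add_smul hl fun k hk hkl => by rw [exchBlock_left x hk, exchU_ne _ _ hkl.symm],
    sum_erase_eq_add_smul hl fun k hk hkl => by
      rw [exchBlock_off x hk hl hkl, exchU_ne _ _ hk.symm],
    sum_erase_eq_add_smul hl fun k hk hkl => by rw [exchU_ne _ _ hk.symm, exchU_ne _ _ hkl.symm],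
    exchU_self, exchU_ne _ _ hl.symm, exchBlock_left x hl, exchBlock_diag x hl, redPhi₂]
  simp only [Matrix.mul_smul, Matrix.smul_mul, smul_smul, transpose_smul, zero_sub, Matrix.mul_neg,
    Matrix.mul_add]
  match_scalars <;> field_simp

theorem bigPhi_exch_diag {i j : Fin N} (hj : j ≠ i) :
    (g.bigPhi (exch x) i).submatrix (Prod.mk j) (Prod.mk j) =
      ((N : ℝ)⁻¹ ^ 2) • g.redPhi₃ (N : ℝ)⁻¹ x := by
  have hN : (N : ℝ) ≠ 0 := Nat.cast_ne_zero.2 (i.pos).ne'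
  rw [bigPhi_exch, bigQ_submatrix, if_neg hj, exchBlock_diag x hj, exchBlock_left x hj,
    exchBlock_right x hj, sum_exchBlock_row x hj, sum_exchBlock_col x hj,
    sum_erase_eq_add_smul hj fun k hk hkj => by
      rw [exchBlock_off x hj hk hkj.symm, exchU_ne _ _ hkj.symm],
    sum_erase_eq_add_smul hj fun k hk hkj => by
      rw [exchBlock_off x hk hj hkj, exchU_ne _ _ hkj.symm],
    sum_erase_eq_add_smul hj fun k hk hkj => by rw [exchU_ne _ _ hkj.symm],
    exchU_self, exchBlock_diag x hj, redPhi₃, redPhiCommon]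
  simp only [Matrix.mul_smul, Matrix.smul_mul, smul_smul, transpose_smul, zero_sub, Matrix.mul_neg,
    Matrix.neg_mul, transpose_neg]
  match_scalars <;> field_simp

theorem bigPhi_exch_off {i j l : Fin N} (hj : j ≠ i) (hl : l ≠ i) (hjl : j ≠ l) :
    (g.bigPhi (exch x) i).submatrix (Prod.mk j) (Prod.mk l) =
      ((N : ℝ)⁻¹ ^ 2) • g.redPhi₄ (N : ℝ)⁻¹ x := by
  have hN : (N : ℝ) ≠ 0 := Nat.cast_ne_zero.2 (i.pos).ne'
  rw [bigPhi_exch, bigQ_submatrix, if_neg hj, if_neg hl, exchBlock_off x hj hl hjl,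
    exchBlock_left x hl, exchBlock_right x hj, sum_exchBlock_row x hj, sum_exchBlock_col x hl,
    sum_erase_eq_add_add_smul hj hl hjl fun k hk hkj hkl => by
      rw [exchBlock_off x hj hk hkj.symm, exchU_ne _ _ hkl.symm],
    sum_erase_eq_add_add_smul hj hl hjl fun k hk hkj hkl => by
      rw [exchBlock_off x hk hl hkl, exchU_ne _ _ hkj.symm],
    sum_erase_eq_add_add_smul hj hl hjl fun k hk hkj hkl => by
      rw [exchU_ne _ _ hkj.symm, exchU_ne _ _ hkl.symm],
    exchU_self, exchU_self, exchU_ne _ _ hjl, exchU_ne _ _ hjl.symm, exchBlock_diag x hj,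
    exchBlock_diag x hl, exchBlock_off x hj hl hjl, redPhi₄, redPhiCommon]
  simp only [Matrix.mul_smul, Matrix.smul_mul, smul_smul, transpose_smul, zero_sub, Matrix.mul_neg,
    Matrix.neg_mul, transpose_neg]
  match_scalars <;> field_simp

end Reduction

end LQGame

/-! ### Regularity of the reduced field and its value at h = 0 -/

namespace LQGame

variable {n m : ℕ} (g : LQGame n m)

/-- The symmetric part of a square matrix. -/
noncomputable def symPart (X : Matrix (Fin n) (Fin n) ℝ) : Matrix (Fin n) (Fin n) ℝ :=
  (2 : ℝ)⁻¹ • (X + Xᵀ)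

theorem symPart_isSymm (X : Matrix (Fin n) (Fin n) ℝ) : (symPart X).IsSymm := by
  simp [IsSymm, symPart, add_comm]

theorem symPart_of_isSymm {X : Matrix (Fin n) (Fin n) ℝ} (hX : X.IsSymm) : symPart X = X := by
  rw [symPart, hX.eq]
  module

/-- The vector field of the rescaled large Riccati system for exchangeable tuples, with `h = 1 / N`;
the limit system corresponds to `h = 0`. -/
noncomputable def redField (h : ℝ) (x : Quad n) : Quad n :=
  (-symPart (g.redPhi₁ h x), -g.redPhi₂ h x, -symPart (g.redPhi₃ h x), -symPart (g.redPhi₄ h x))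

/-- The rescaled blocks of the terminal value of the large Riccati system. -/
noncomputable def redTerminal (h : ℝ) : Quad n :=
  ((1 - h • g.Γf)ᵀ * g.Qf * (1 - h • g.Γf), -((1 - h • g.Γf)ᵀ * g.Qf * g.Γf),
    g.Γfᵀ * g.Qf * g.Γf, g.Γfᵀ * g.Qf * g.Γf)

/-- At h = 0 the coupling terms drop out and only the first component remains; the second row then
involves the first two only. This triangular structure closes the limit system. -/
theorem redPhi₁_zero (x : Quad n) : g.redPhi₁ 0 x = -g.Ψ₁ x.1 := by
  simp [redPhi₁, Ψ₁]
  abel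

theorem redPhi₂_zero (x : Quad n) : g.redPhi₂ 0 x = -g.Ψ₂ x.1 x.2.1 := by
  simp [redPhi₂, Ψ₂, redU, redW, Matrix.mul_add, Matrix.add_mul, Matrix.mul_assoc]
  abel

theorem redTerminal_zero :
    g.redTerminal 0 = (g.Qf, -(g.Qf * g.Γf), g.Γfᵀ * g.Qf * g.Γf, g.Γfᵀ * g.Qf * g.Γf) := by
  simp [redTerminal]

theorem Ψ₁_isSymm (hQ : g.Q.IsSymm) (hR : g.R.IsSymm) {X : Matrix (Fin n) (Fin n) ℝ}
    (hX : X.IsSymm) : (g.Ψ₁ X).IsSymm := by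
  have hH : ((g.R₁ X)⁻¹)ᵀ = (g.R₁ X)⁻¹ := by
    rw [transpose_nonsing_inv]
    simp [R₁, hR.eq, hX.eq, Matrix.mul_assoc]
  simp only [IsSymm, Ψ₁, transpose_sub, transpose_mul, transpose_transpose, hH, hX.eq, hQ.eq,
    Matrix.mul_assoc]
  abel

section Regularity

open Filter Topology
open scoped Matrix.Norms.Frobenius

theorem continuous_redTerminal : Continuous g.redTerminal := by
  unfold redTerminal
  fun_prop

theorem contDiffAt_R₁ (p : ℝ × Quad n) :
    ContDiffAt ℝ 1 (fun q : ℝ × Quad n => g.R₁ q.2.1) p := by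
  unfold R₁
  fun_prop

theorem contDiffAt_redS (p : ℝ × Quad n) :
    ContDiffAt ℝ 1 (fun q : ℝ × Quad n => g.redS q.1 q.2) p := by
  unfold redS
  fun_prop

theorem contDiffAt_redI {p : ℝ × Quad n} (hR : IsUnit (g.R₁ p.2.1)) :
    ContDiffAt ℝ 1 (fun q : ℝ × Quad n => g.redI q.1 q.2) p := by
  have hH := (g.contDiffAt_R₁ p).matrix_inv hR
  have hS := g.contDiffAt_redS p
  unfold redI
  fun_prop

theorem contDiffAt_redField {p : ℝ × Quad n} (hR : IsUnit (g.R₁ p.2.1))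
    (hI : IsUnit (g.redI p.1 p.2)) :
    ContDiffAt ℝ 1 (fun q : ℝ × Quad n => g.redField q.1 q.2) p := by
  have hH := (g.contDiffAt_R₁ p).matrix_inv hR
  have hS := g.contDiffAt_redS p
  have hI' := (g.contDiffAt_redI hR).matrix_inv hI
  have hM : ContDiffAt ℝ 1 (fun q : ℝ × Quad n => g.redM q.1 q.2) p := by
    unfold redM
    fun_prop
  have hU : ContDiffAt ℝ 1 (fun q : ℝ × Quad n => g.redU q.1 q.2) p := by
    unfold redU
    fun_prop
  have hW : ContDiffAt ℝ 1 (fun q : ℝ × Quad n => g.redW q.1 q.2) p := by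
    unfold redW
    fun_prop
  have hX : ContDiffAt ℝ 1 (fun q : ℝ × Quad n => g.redX q.2) p := by
    unfold redX
    fun_prop
  have hC : ContDiffAt ℝ 1 (fun q : ℝ × Quad n => g.redPhiCommon q.1 q.2) p := by
    unfold redPhiCommon
    fun_prop
  have h₁ : ContDiffAt ℝ 1 (fun q : ℝ × Quad n => g.redPhi₁ q.1 q.2) p := by
    unfold redPhi₁
    fun_prop
  have h₂ : ContDiffAt ℝ 1 (fun q : ℝ × Quad n => g.redPhi₂ q.1 q.2) p := by
    unfold redPhi₂
    fun_prop
  have h₃ : ContDiffAt ℝ 1 (fun q : ℝ × Quad n => g.redPhi₃ q.1 q.2) p := by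
    unfold redPhi₃
    fun_prop
  have h₄ : ContDiffAt ℝ 1 (fun q : ℝ × Quad n => g.redPhi₄ q.1 q.2) p := by
    unfold redPhi₄
    fun_prop
  unfold redField symPart
  fun_prop

/-- The constraints of the large Riccati system, in terms of the rescaled blocks and with a lower
bound `c` for the two positive definite matrices. -/
structure RedConstraint (c : ℝ) (p : ℝ × Quad n) : Prop where
  isUnit_R : IsUnit (g.R₁ p.2.1)
  isUnit_I : IsUnit (g.redI p.1 p.2)
  posSemidef_R : (g.R₁ p.2.1).IsSymm → (g.R₁ p.2.1 - c • (1 : Matrix (Fin m) (Fin m) ℝ)).PosSemidef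
  posSemidef_add : (g.R₁ p.2.1 + p.1 ^ 2 • g.redS p.1 p.2).IsSymm →
    (g.R₁ p.2.1 + p.1 ^ 2 • g.redS p.1 p.2 - c • (1 : Matrix (Fin m) (Fin m) ℝ)).PosSemidef

/-- At h = 0 the matrix `redI` is 1 and the term with `redS` vanishes, so positivity of `R₁` alone
yields all constraints nearby. The neighbourhood also contains non-symmetric states, hence the
symmetry premises in `RedConstraint`. -/
theorem exists_eventually_redConstraint {x : Quad n} (hx : (g.R₁ x.1).PosDef) :
    ∃ c > 0, ∀ᶠ p in 𝓝 ((0 : ℝ), x), g.RedConstraint c p := by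
  obtain ⟨c, hc, hev⟩ := hx.exists_eventually_sub_smul_one_posSemidef
  have hR : Tendsto (fun q : ℝ × Quad n => g.R₁ q.2.1) (𝓝 (0, x)) (𝓝 (g.R₁ x.1)) :=
    (g.contDiffAt_R₁ (0, x)).continuousAt
  have hS : Tendsto (fun q : ℝ × Quad n => g.redS q.1 q.2) (𝓝 (0, x)) (𝓝 (g.redS 0 x)) :=
    (g.contDiffAt_redS (0, x)).continuousAt
  have hI : Tendsto (fun q : ℝ × Quad n => g.redI q.1 q.2) (𝓝 (0, x)) (𝓝 1) := by
    rw [← show g.redI 0 x = 1 by simp [redI]]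
    exact (g.contDiffAt_redI (p := (0, x)) hx.isUnit).continuousAt
  have hRS : Tendsto (fun q : ℝ × Quad n => g.R₁ q.2.1 + q.1 ^ 2 • g.redS q.1 q.2) (𝓝 (0, x))
      (𝓝 (g.R₁ x.1)) := by
    have h0 : Tendsto (fun q : ℝ × Quad n => q.1 ^ 2) (𝓝 (0, x)) (𝓝 (0 ^ 2)) :=
      (continuous_fst.pow 2).continuousAt
    simpa using hR.add (h0.smul hS)
  refine ⟨c, hc, ?_⟩
  filter_upwards [hR.eventually hev, hRS.eventually hev,
    hR.eventually (Units.isOpen.mem_nhds hx.isUnit),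
    hI.eventually (Units.isOpen.mem_nhds isUnit_one)] with p h₁ h₂ h₃ h₄
  exact ⟨h₃, h₄, h₁, h₂⟩

end Regularity

end LQGame

/-- The antisymmetric part has zero derivative and vanishes at T. -/
theorem Matrix.isSymm_of_hasDerivWithinAt {a : Type*} [Fintype a] {T : ℝ} {X X' : ℝ → Matrix a a ℝ}
    (hX : ∀ t ∈ Icc 0 T, HasDerivWithinAt X (X' t) (Icc 0 T) t)
    (hX' : ∀ t ∈ Icc 0 T, (X' t).IsSymm) (hT : (X T).IsSymm) :
    ∀ t ∈ Icc 0 T, (X t).IsSymm := by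
  intro t ht
  ext i j
  have hd : ∀ s ∈ Icc 0 T, HasDerivWithinAt (fun u => X u j i - X u i j) 0 (Icc 0 T) s := by
    intro s hs
    have h := (hasDerivWithinAt_matrix.1 (hX s hs) j i).sub (hasDerivWithinAt_matrix.1 (hX s hs) i j)
    rwa [(hX' s hs).apply, sub_self] at h
  have hc := constant_of_has_deriv_right_zero (fun s hs => (hd s hs).continuousWithinAt)
    fun s hs => (hd s (Ico_subset_Icc_self hs)).mono_of_mem_nhdsWithin
      (Filter.mem_of_superset (Icc_mem_nhdsGE hs.2) (Icc_subset_Icc_left hs.1))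
  have h1 := hc t ht
  have h2 := hc T ⟨ht.1.trans ht.2, le_rfl⟩
  simp only [hT.apply, sub_self] at h2
  rw [← h2] at h1
  rw [transpose_apply]
  linarith

theorem Equiv.Perm.exists_apply_eq₂ {a : Type*} [DecidableEq a] {i₀ j₀ i j : a} (h₀ : i₀ ≠ j₀)
    (h : i ≠ j) : ∃ σ : Equiv.Perm a, σ i₀ = i ∧ σ j₀ = j := by
  refine ⟨Equiv.swap (Equiv.swap i₀ i j₀) j * Equiv.swap i₀ i, ?_, by simp⟩
  rw [Equiv.Perm.mul_apply, Equiv.swap_apply_left]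
  refine Equiv.swap_apply_of_ne_of_ne (fun h1 => h₀ ?_) h
  exact (Equiv.swap i₀ i).injective ((Equiv.swap_apply_left i₀ i).trans h1)

theorem Equiv.Perm.exists_apply_eq₃ {a : Type*} [DecidableEq a] {i₀ j₀ l₀ i j l : a}
    (hij₀ : i₀ ≠ j₀) (hil₀ : i₀ ≠ l₀) (hjl₀ : j₀ ≠ l₀) (hij : i ≠ j) (hil : i ≠ l) (hjl : j ≠ l) :
    ∃ σ : Equiv.Perm a, σ i₀ = i ∧ σ j₀ = j ∧ σ l₀ = l := by
  obtain ⟨σ, hi, hj⟩ := Equiv.Perm.exists_apply_eq₂ hij₀ hij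
  refine ⟨Equiv.swap (σ l₀) l * σ, ?_, ?_, by simp⟩
  · rw [Equiv.Perm.mul_apply, hi]
    exact Equiv.swap_apply_of_ne_of_ne (fun h => hil₀ (σ.injective (hi.trans h))) hil
  · rw [Equiv.Perm.mul_apply, hj]
    exact Equiv.swap_apply_of_ne_of_ne (fun h => hjl₀ (σ.injective (hj.trans h))) hjl

/-! ### Correspondence between reduced and large solutions -/

namespace LQGame

variable {n m : ℕ} (g : LQGame n m)

section Exchangeable

variable {N : ℕ}

/-- The symmetry conditions under which the exchangeable tuple described by `x` is symmetric. -/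
def Quad.IsSymm (x : Quad n) : Prop := x.1.IsSymm ∧ x.2.2.1.IsSymm ∧ x.2.2.2.IsSymm

theorem exch_isSymm {x : Quad n} (hx : Quad.IsSymm x) (i : Fin N) : (exch x i).IsSymm := by
  obtain ⟨h₁, h₃, h₄⟩ := hx
  have h : ∀ j l : Fin N, (exchBlock x i j l)ᵀ = exchBlock x i l j := by
    intro j l
    by_cases hj : j = i <;> by_cases hl : l = i <;> by_cases hjl : j = l <;>
      simp_all [exchBlock, h₁.eq, h₃.eq, h₄.eq, eq_comm]
  ext p q
  exact congrFun (congrFun (h q.1 p.1) p.2) q.2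

/-- The symmetry is inherited from the large right-hand side rather than computed. For the fourth
block it uses that positions (2,3) and (3,2) carry the same block; three players are needed for
these positions to exist. -/
theorem redPhi_isSymm (hQ : g.Q.IsSymm) (hR : g.R.IsSymm) (hN : 3 ≤ N) {x : Quad n}
    (hx : Quad.IsSymm x) : (g.redPhi₁ (N : ℝ)⁻¹ x).IsSymm ∧ (g.redPhi₃ (N : ℝ)⁻¹ x).IsSymm ∧
      (g.redPhi₄ (N : ℝ)⁻¹ x).IsSymm := by
  have hN0 : ((N : ℝ)⁻¹ ^ 2) ≠ 0 := by positivity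
  let i₀ : Fin N := ⟨0, by omega⟩
  let i₁ : Fin N := ⟨1, by omega⟩
  let i₂ : Fin N := ⟨2, by omega⟩
  have h10 : i₁ ≠ i₀ := by simp [i₀, i₁]
  have h20 : i₂ ≠ i₀ := by simp [i₀, i₂]
  have h12 : i₁ ≠ i₂ := by simp [i₁, i₂]
  have hP := (g.bigPhi_isSymm hQ hR (fun k => exch_isSymm hx k) i₀).eq
  have hb : ∀ j l, ((g.bigPhi (exch x) i₀).submatrix (Prod.mk j) (Prod.mk l))ᵀ =
      (g.bigPhi (exch x) i₀).submatrix (Prod.mk l) (Prod.mk j) := fun j l => by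
    rw [transpose_submatrix, hP]
  refine ⟨?_, ?_, ?_⟩
  · rw [IsSymm, ← g.bigPhi_exch_self x i₀, hb]
  · have h := hb i₁ i₁
    rw [g.bigPhi_exch_diag x h10, transpose_smul] at h
    exact smul_right_injective _ hN0 h
  · have h := hb i₁ i₂
    rw [g.bigPhi_exch_off x h10 h20 h12, g.bigPhi_exch_off x h20 h10 h12.symm,
      transpose_smul] at h
    exact smul_right_injective _ hN0 h

/-- The symmetrization in `redField` is invisible on symmetric states, the only ones that correspond
to the large system. -/
theorem redField_of_isSymm (hQ : g.Q.IsSymm) (hR : g.R.IsSymm) (hN : 3 ≤ N) {x : Quad n}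
    (hx : Quad.IsSymm x) : g.redField (N : ℝ)⁻¹ x = (-g.redPhi₁ (N : ℝ)⁻¹ x,
      -g.redPhi₂ (N : ℝ)⁻¹ x, -g.redPhi₃ (N : ℝ)⁻¹ x, -g.redPhi₄ (N : ℝ)⁻¹ x) := by
  obtain ⟨h₁, h₃, h₄⟩ := g.redPhi_isSymm hQ hR hN hx
  rw [redField, symPart_of_isSymm h₁, symPart_of_isSymm h₃, symPart_of_isSymm h₄]

theorem exch_redField (hQ : g.Q.IsSymm) (hR : g.R.IsSymm) (hN : 3 ≤ N) {x : Quad n}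
    (hx : Quad.IsSymm x) (i : Fin N) :
    exch (g.redField (N : ℝ)⁻¹ x) i = -g.bigPhi (exch x) i := by
  have hP := (g.bigPhi_isSymm hQ hR (fun k => exch_isSymm hx k) i).eq
  have key : ∀ j l, exchBlock (g.redField (N : ℝ)⁻¹ x) i j l =
      -(g.bigPhi (exch x) i).submatrix (Prod.mk j) (Prod.mk l) := by
    intro j l
    rw [g.redField_of_isSymm hQ hR hN hx]
    by_cases hj : j = i
    · subst hj
      by_cases hl : l = j
      · subst hl
        rw [exchBlock_self, bigPhi_exch_self]
      · rw [exchBlock_left _ hl, bigPhi_exch_left g x hl, smul_neg]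
    · by_cases hl : l = i
      · subst hl
        rw [exchBlock_right _ hj, ← hP, ← transpose_submatrix, bigPhi_exch_left g x hj,
          transpose_neg, transpose_smul, smul_neg]
      · by_cases hjl : j = l
        · subst hjl
          rw [exchBlock_diag _ hj, bigPhi_exch_diag g x hj, smul_neg]
        · rw [exchBlock_off _ hj hl hjl, bigPhi_exch_off g x hj hl hjl, smul_neg]
  ext p q
  exact congrFun (congrFun (key p.1 q.1) p.2) q.2

theorem redTerminal_isSymm (hQf : g.Qf.IsSymm) (h : ℝ) : Quad.IsSymm (g.redTerminal h) := by
  refine ⟨?_, ?_, ?_⟩ <;> simp [IsSymm, redTerminal, hQf.eq, Matrix.mul_assoc]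

theorem exch_redTerminal (hQf : g.Qf.IsSymm) (i : Fin N) :
    exch (g.redTerminal (N : ℝ)⁻¹) i = g.bigQf N i := by
  have key : ∀ j l, exchBlock (g.redTerminal (N : ℝ)⁻¹) i j l =
      (g.bigQf N i).submatrix (Prod.mk j) (Prod.mk l) := by
    intro j l
    rw [bigQf, bigK_conj_submatrix]
    by_cases hj : j = i <;> by_cases hl : l = i <;> by_cases hjl : j = l <;>
      simp_all [exchBlock, redTerminal, hQf.eq, Matrix.mul_assoc, smul_smul, sq]
  ext p q
  exact congrFun (congrFun (key p.1 q.1) p.2) q.2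

theorem hasDerivWithinAt_exch {y : ℝ → Quad n} {y' : Quad n} {s : Set ℝ} {t : ℝ}
    (h₁ : HasDerivWithinAt (fun u => (y u).1) y'.1 s t)
    (h₂ : HasDerivWithinAt (fun u => (y u).2.1) y'.2.1 s t)
    (h₃ : HasDerivWithinAt (fun u => (y u).2.2.1) y'.2.2.1 s t)
    (h₄ : HasDerivWithinAt (fun u => (y u).2.2.2) y'.2.2.2 s t) (i : Fin N) :
    HasDerivWithinAt (fun u => exch (y u) i) (exch y' i) s t := by
  rw [hasDerivWithinAt_matrix] at h₁ h₂ h₃ h₄ ⊢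
  intro p q
  simp only [exch, exchBlock, of_apply]
  split_ifs
  · exact h₁ _ _
  · exact (h₂ _ _).const_mul _
  · exact (h₂ _ _).const_mul _
  · exact (h₃ _ _).const_mul _
  · exact (h₄ _ _).const_mul _

end Exchangeable

section Correspondence

variable {N : ℕ}

/-- Solutions of the reduced system give solutions of the large Riccati system. -/
theorem isRiccatiSolution_exch (hQ : g.Q.IsSymm) (hQf : g.Qf.IsSymm) (hR : g.R.IsSymm)
    (hN : 3 ≤ N) {c : ℝ} (hc : 0 < c) {y : ℝ → Quad n} (hyT : y g.T = g.redTerminal (N : ℝ)⁻¹)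
    (h₁ : ∀ t ∈ Icc 0 g.T,
      HasDerivWithinAt (fun u => (y u).1) (g.redField (N : ℝ)⁻¹ (y t)).1 (Icc 0 g.T) t)
    (h₂ : ∀ t ∈ Icc 0 g.T,
      HasDerivWithinAt (fun u => (y u).2.1) (g.redField (N : ℝ)⁻¹ (y t)).2.1 (Icc 0 g.T) t)
    (h₃ : ∀ t ∈ Icc 0 g.T,
      HasDerivWithinAt (fun u => (y u).2.2.1) (g.redField (N : ℝ)⁻¹ (y t)).2.2.1 (Icc 0 g.T) t)
    (h₄ : ∀ t ∈ Icc 0 g.T,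
      HasDerivWithinAt (fun u => (y u).2.2.2) (g.redField (N : ℝ)⁻¹ (y t)).2.2.2 (Icc 0 g.T) t)
    (hy : ∀ t ∈ Icc 0 g.T, g.RedConstraint c ((N : ℝ)⁻¹, y t)) :
    g.IsRiccatiSolution N (fun i t => exch (y t) i) ∧
      ∀ i : Fin N, ∀ t ∈ Icc 0 g.T, (g.bigR (fun k => exch (y t) k) i -
        c • (1 : Matrix (Fin m) (Fin m) ℝ)).PosSemidef := by
  have hsT := g.redTerminal_isSymm hQf (N : ℝ)⁻¹
  rw [← hyT] at hsT
  have hneg : ∀ X : Matrix (Fin n) (Fin n) ℝ, (-symPart X).IsSymm := fun X =>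
    (symPart_isSymm X).neg
  -- Here the symmetrization in `redField` pays off: the derivatives are symmetric at every state,
  -- so symmetry propagates from T without a uniqueness argument.
  have hsymm : ∀ t ∈ Icc 0 g.T, Quad.IsSymm (y t) := fun t ht =>
    ⟨isSymm_of_hasDerivWithinAt h₁ (fun _ _ => hneg _) hsT.1 t ht,
      isSymm_of_hasDerivWithinAt h₃ (fun _ _ => hneg _) hsT.2.1 t ht,
      isSymm_of_hasDerivWithinAt h₄ (fun _ _ => hneg _) hsT.2.2 t ht⟩
  have hbR : ∀ i : Fin N, ∀ t ∈ Icc 0 g.T, (g.bigR (fun k => exch (y t) k) i -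
      c • (1 : Matrix (Fin m) (Fin m) ℝ)).PosSemidef := by
    intro i t ht
    have hs := g.bigR_isSymm hR (exch_isSymm (hsymm t ht) i)
    rw [bigR_exch] at hs ⊢
    exact (hy t ht).posSemidef_R hs
  refine ⟨⟨fun i t ht => exch_isSymm (hsymm t ht) i, fun i t ht => ?_, fun i => ?_,
    fun i t ht => (hbR i t ht).posDef_of_sub_smul_one hc, fun i t ht => ?_, fun t ht => ?_⟩, hbR⟩
  · have h := hasDerivWithinAt_exch (h₁ t ht) (h₂ t ht) (h₃ t ht) (h₄ t ht) i
    rwa [g.exch_redField hQ hR hN (hsymm t ht)] at h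
  · simp only [hyT, g.exch_redTerminal hQf]
  · have hs := (g.bigR_isSymm hR (exch_isSymm (hsymm t ht) i)).add
      (g.bigS_isSymm (exch_isSymm (hsymm t ht) i))
    rw [bigR_exch, bigS_exch] at hs ⊢
    exact ((hy t ht).posSemidef_add hs).posDef_of_sub_smul_one hc
  · change IsUnit (g.bigI (exch (y t)))
    rw [bigI_exch _ _ (by omega)]
    exact (hy t ht).isUnit_I

/-- The rescaled blocks of the first matrix of a tuple. -/
noncomputable def quadOf (hN : 3 ≤ N) (X : Matrix (Fin N × Fin n) (Fin N × Fin n) ℝ) : Quad n :=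
  (block X ⟨0, by omega⟩ ⟨0, by omega⟩, (N : ℝ) • block X ⟨0, by omega⟩ ⟨1, by omega⟩,
    ((N : ℝ) ^ 2) • block X ⟨1, by omega⟩ ⟨1, by omega⟩,
    ((N : ℝ) ^ 2) • block X ⟨1, by omega⟩ ⟨2, by omega⟩)

theorem quadOf_exch (hN : 3 ≤ N) (x : Quad n) : quadOf hN (exch x ⟨0, by omega⟩) = x := by
  have hN0 : (N : ℝ) ≠ 0 := Nat.cast_ne_zero.2 (by omega)
  have hb : ∀ i j l : Fin N, block (exch x i) j l = exchBlock x i j l := fun i j l => rfl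
  simp only [quadOf, hb]
  rw [exchBlock_self, exchBlock_left x (by simp), exchBlock_diag x (by simp),
    exchBlock_off x (by simp) (by simp) (by simp)]
  ext <;> simp [hN0]

variable {g} in
/-- Solutions of the large Riccati system are exchangeable tuples. -/
theorem IsRiccatiSolution.eq_exch {P : Fin N → ℝ → Matrix (Fin N × Fin n) (Fin N × Fin n) ℝ}
    (h : g.IsRiccatiSolution N P) (hN : 3 ≤ N) {t : ℝ} (ht : t ∈ Icc 0 g.T) :
    (fun k => P k t) = exch (quadOf hN (P ⟨0, by omega⟩ t)) ∧
      Quad.IsSymm (quadOf hN (P ⟨0, by omega⟩ t)) := by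
  have hN0 : (N : ℝ) ≠ 0 := Nat.cast_ne_zero.2 (by omega)
  let i₀ : Fin N := ⟨0, by omega⟩
  let i₁ : Fin N := ⟨1, by omega⟩
  let i₂ : Fin N := ⟨2, by omega⟩
  have h01 : i₀ ≠ i₁ := by simp [i₀, i₁]
  have h02 : i₀ ≠ i₂ := by simp [i₀, i₂]
  have h12 : i₁ ≠ i₂ := by simp [i₁, i₂]
  -- Triples (i, j, l) with the same pattern of coincidences form one orbit of the permutation
  -- group, so representatives among the first three players suffice.
  have hperm : ∀ (σ : Equiv.Perm (Fin N)) (i j l : Fin N),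
      block (P (σ i) t) (σ j) (σ l) = block (P i t) j l := fun σ i j l =>
    congrArg (fun X => block X j l) (congrFun (h.relabel_eq σ ht) i)
  have hs : ∀ i j l : Fin N, (block (P i t) j l)ᵀ = block (P i t) l j := fun i j l =>
    congrArg (fun X => block X l j) (h.symm i t ht)
  have h1 : ∀ i, block (P i t) i i = block (P i₀ t) i₀ i₀ := fun i => by
    simpa using hperm (Equiv.swap i₀ i) i₀ i₀ i₀
  have h2 : ∀ i l, l ≠ i → block (P i t) i l = block (P i₀ t) i₀ i₁ := fun i l hl => by
    obtain ⟨σ, rfl, rfl⟩ := Equiv.Perm.exists_apply_eq₂ h01 hl.symm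
    exact hperm σ _ _ _
  have h3 : ∀ i l, l ≠ i → block (P i t) l l = block (P i₀ t) i₁ i₁ := fun i l hl => by
    obtain ⟨σ, rfl, rfl⟩ := Equiv.Perm.exists_apply_eq₂ h01 hl.symm
    exact hperm σ _ _ _
  have h4 : ∀ i j l, j ≠ i → l ≠ i → j ≠ l → block (P i t) j l = block (P i₀ t) i₁ i₂ :=
    fun i j l hj hl hjl => by
      obtain ⟨σ, rfl, rfl, rfl⟩ := Equiv.Perm.exists_apply_eq₃ h01 h02 h12 hj.symm hl.symm hjl
      exact hperm σ _ _ _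
  set x := quadOf hN (P ⟨0, by omega⟩ t) with hx
  have hx2 : (N : ℝ)⁻¹ • x.2.1 = block (P i₀ t) i₀ i₁ := by
    rw [hx, quadOf, inv_smul_smul₀ hN0]
  have hx3 : ((N : ℝ)⁻¹ ^ 2) • x.2.2.1 = block (P i₀ t) i₁ i₁ := by
    rw [hx, quadOf, inv_pow, inv_smul_smul₀ (pow_ne_zero 2 hN0)]
  have hx4 : ((N : ℝ)⁻¹ ^ 2) • x.2.2.2 = block (P i₀ t) i₁ i₂ := by
    rw [hx, quadOf, inv_pow, inv_smul_smul₀ (pow_ne_zero 2 hN0)]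
  constructor
  · have key : ∀ i j l, block (P i t) j l = exchBlock x i j l := by
      intro i j l
      by_cases hj : j = i
      · subst hj
        by_cases hl : l = j
        · subst hl
          rw [exchBlock_self, h1]
          rfl
        · rw [exchBlock_left x hl, h2 _ _ hl, hx2]
      · by_cases hl : l = i
        · subst hl
          rw [exchBlock_right x hj, ← hs, h2 _ _ hj, ← hx2, transpose_smul]
        · by_cases hjl : j = l
          · subst hjl
            rw [exchBlock_diag x hj, h3 _ _ hj, hx3]
          · rw [exchBlock_off x hj hl hjl, h4 _ _ _ hj hl hjl, hx4]
    funext i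
    ext p q
    exact congrFun (congrFun (key i p.1 q.1) p.2) q.2
  · refine ⟨hs _ _ _, ?_, ?_⟩
    · change (((N : ℝ) ^ 2) • block (P i₀ t) i₁ i₁)ᵀ = _
      rw [transpose_smul, hs]
      rfl
    · change (((N : ℝ) ^ 2) • block (P i₀ t) i₁ i₂)ᵀ = ((N : ℝ) ^ 2) • block (P i₀ t) i₁ i₂
      rw [transpose_smul, hs, h4 i₀ i₂ i₁ h02.symm h01.symm h12.symm]

end Correspondence

end LQGame

/-! ### Necessity: from asymptotic solvability to the limit system -/

namespace LQGame

open Filter Topology Metric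
open scoped Matrix.Norms.Frobenius

variable {n m : ℕ} (g : LQGame n m)

theorem RedConstraint.mono {g : LQGame n m} {c c' : ℝ} {p : ℝ × Quad n} (hc : c' ≤ c)
    (h : g.RedConstraint c p) : g.RedConstraint c' p :=
  ⟨h.isUnit_R, h.isUnit_I, fun hs => (h.posSemidef_R hs).sub_smul_one_mono hc,
    fun hs => (h.posSemidef_add hs).sub_smul_one_mono hc⟩

theorem rescaledSize_eq {N : ℕ} (hN : 3 ≤ N) (X : Matrix (Fin N × Fin n) (Fin N × Fin n) ℝ) :
    rescaledSize hN X = ‖(quadOf hN X).1‖ + ‖(quadOf hN X).2.1‖ + ‖(quadOf hN X).2.2.1‖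
      + ‖(quadOf hN X).2.2.2‖ := by
  simp only [quadOf, norm_smul, norm_pow, Real.norm_natCast]
  rfl

theorem norm_quadOf_le_rescaledSize {N : ℕ} (hN : 3 ≤ N)
    (X : Matrix (Fin N × Fin n) (Fin N × Fin n) ℝ) : ‖quadOf hN X‖ ≤ rescaledSize hN X := by
  rw [rescaledSize_eq]
  have h₁ := norm_nonneg (quadOf hN X).1
  have h₂ := norm_nonneg (quadOf hN X).2.1
  have h₃ := norm_nonneg (quadOf hN X).2.2.1
  have h₄ := norm_nonneg (quadOf hN X).2.2.2
  simp only [Prod.norm_def, max_le_iff]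
  refine ⟨?_, ?_, ?_, ?_⟩ <;> linarith

theorem rescaledSize_exch_le {N : ℕ} (hN : 3 ≤ N) (x : Quad n) :
    rescaledSize hN (exch x ⟨0, by omega⟩) ≤ 4 * ‖x‖ := by
  rw [rescaledSize_eq, quadOf_exch]
  have h₁ : ‖x.1‖ ≤ ‖x‖ := norm_fst_le x
  have h : ‖x.2‖ ≤ ‖x‖ := norm_snd_le x
  have h₂ : ‖x.2.1‖ ≤ ‖x.2‖ := norm_fst_le x.2
  have h' : ‖x.2.2‖ ≤ ‖x.2‖ := norm_snd_le x.2
  have h₃ : ‖x.2.2.1‖ ≤ ‖x.2.2‖ := norm_fst_le x.2.2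
  have h₄ : ‖x.2.2.2‖ ≤ ‖x.2.2‖ := norm_snd_le x.2.2
  linarith

theorem hasDerivWithinAt_quadOf {N : ℕ} (hN : 3 ≤ N)
    {X : ℝ → Matrix (Fin N × Fin n) (Fin N × Fin n) ℝ}
    {X' : Matrix (Fin N × Fin n) (Fin N × Fin n) ℝ} {s : Set ℝ} {t : ℝ}
    (h : HasDerivWithinAt X X' s t) :
    HasDerivWithinAt (fun u => quadOf hN (X u)) (quadOf hN X') s t := by
  have hb : ∀ j l, HasDerivWithinAt (fun u => block (X u) j l) (block X' j l) s t := fun j l =>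
    hasDerivWithinAt_matrix.2 fun p q => hasDerivWithinAt_matrix.1 h (j, p) (l, q)
  have hr : ∀ (r : ℝ) (j l : Fin N),
      HasDerivWithinAt (fun u => r • block (X u) j l) (r • block X' j l) s t := fun r j l =>
    (hb j l).const_smul r
  exact (hb _ _).prodMk ((hr _ _ _).prodMk ((hr _ _ _).prodMk (hr _ _ _)))

/-- A uniform neighbourhood of a compact set of admissible states in which the reduced vector fields
are Lipschitz and the constraints hold. -/
theorem exists_uniform_neighbourhood {s : Set (Quad n)} (hs : IsCompact s)
    (hpos : ∀ x ∈ s, (g.R₁ x.1).PosDef) :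
    ∃ δ > 0, ∃ c > 0, ∃ K : NNReal, ∀ x ∈ s,
      LipschitzOnWith K (fun q : ℝ × Quad n => g.redField q.1 q.2) (closedBall (0, x) δ) ∧
        ∀ q ∈ closedBall ((0 : ℝ), x) δ, g.RedConstraint c q := by
  have hs' : IsCompact ((fun x : Quad n => ((0 : ℝ), x)) '' s) := hs.image (by fun_prop)
  obtain ⟨δ, hδ, c, hc, K, h⟩ := hs'.exists_uniform_lipschitzOnWith
    (f := fun q : ℝ × Quad n => g.redField q.1 q.2) (by
      rintro _ ⟨x, hx, rfl⟩
      exact g.contDiffAt_redField (hpos x hx).isUnit (by simp [redI]))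
    g.RedConstraint (fun c c' x hcc h => h.mono hcc) (by
      rintro _ ⟨x, hx, rfl⟩
      exact g.exists_eventually_redConstraint (hpos x hx))
  exact ⟨δ, hδ, c, hc, K, fun x hx => h _ (mem_image_of_mem _ hx)⟩

theorem redField_zero_fst (x : Quad n) : (g.redField 0 x).1 = symPart (g.Ψ₁ x.1) := by
  simp only [redField, redPhi₁_zero, symPart, transpose_neg]
  module

theorem redField_zero_snd (x : Quad n) : (g.redField 0 x).2.1 = g.Ψ₂ x.1 x.2.1 := by
  simp only [redField, redPhi₂_zero, neg_neg]

/-- The first two rescaled blocks for one large N solve the limit system up to O(1/N), and the exact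
solution shadowing them is the required one. -/
theorem AsymptoticallySolvable.exists_isLimitSolution {g : LQGame n m} (hT : 0 < g.T)
    (hQ : g.Q.IsSymm) (hQf : g.Qf.IsSymm) (hR : g.R.IsSymm) (h : g.AsymptoticallySolvable) :
    ∃ L₁ L₂ : ℝ → Matrix (Fin n) (Fin n) ℝ, g.IsLimitSolution L₁ L₂ := by
  obtain ⟨N₀, hN₀, c₀, hc₀, C, h⟩ := h
  -- This set contains the rescaled solutions for every N ≥ N₀. The bound c₀ keeps `R₁` uniformly
  -- positive, so s is closed and consists of admissible states; δ, K and ε are thus fixed before N.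
  let s : Set (Quad n) :=
    {x | ‖x‖ ≤ C ∧ (g.R₁ x.1 - c₀ • (1 : Matrix (Fin m) (Fin m) ℝ)).PosSemidef}
  have hs : IsCompact s := by
    have : ProperSpace (Quad n) := FiniteDimensional.proper ℝ _
    refine isCompact_of_isClosed_isBounded ?_ ?_
    · refine (isClosed_le continuous_norm continuous_const).inter ?_
      refine isClosed_setOf_posSemidef.preimage
        (f := fun x : Quad n => g.R₁ x.1 - c₀ • (1 : Matrix (Fin m) (Fin m) ℝ)) ?_
      unfold R₁
      fun_prop
    · exact (isBounded_closedBall (x := (0 : Quad n)) (r := C)).subset fun x hx => by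
        simpa using hx.1
  obtain ⟨δ, hδ, c, hc, K, hK⟩ := g.exists_uniform_neighbourhood hs
    fun x hx => hx.2.posDef_of_sub_smul_one hc₀
  obtain ⟨ε, hε, hshadow⟩ := exists_terminal_solution_near_approximate_solution
    (E := Matrix (Fin n) (Fin n) ℝ × Matrix (Fin n) (Fin n) ℝ) g.T hT K hδ
  have hinv : Tendsto (fun N : ℕ => (N : ℝ)⁻¹) atTop (𝓝 0) := tendsto_inv_atTop_nhds_zero_nat
  have hterm : Tendsto (fun N : ℕ => dist (g.redTerminal (N : ℝ)⁻¹) (g.redTerminal 0)) atTop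
      (𝓝 0) := tendsto_iff_dist_tendsto_zero.1 ((g.continuous_redTerminal.tendsto 0).comp hinv)
  have hKinv : Tendsto (fun N : ℕ => (K : ℝ) * (N : ℝ)⁻¹) atTop (𝓝 0) := by
    simpa using hinv.const_mul (K : ℝ)
  obtain ⟨N, hNδ, hNε, hNT, hN⟩ := ((hinv.eventually_le_const hδ).and
    ((hKinv.eventually_le_const hε).and ((hterm.eventually_le_const hε).and
      (eventually_ge_atTop N₀)))).exists
  obtain ⟨P, hP, hPC, hPR, -⟩ := h N hN
  have hN3 : 3 ≤ N := hN₀.trans hN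
  set x : ℝ → Quad n := fun t => quadOf hN3 (P ⟨0, by omega⟩ t) with hx
  have hPx : ∀ t ∈ Icc 0 g.T, (fun k => P k t) = exch (x t) ∧ Quad.IsSymm (x t) := fun t ht =>
    hP.eq_exch hN3 ht
  have hxs : ∀ t ∈ Icc 0 g.T, x t ∈ s := fun t ht => by
    refine ⟨(norm_quadOf_le_rescaledSize hN3 _).trans (hPC t ht), ?_⟩
    have h1 := hPR ⟨0, by omega⟩ t ht
    rwa [(hPx t ht).1, bigR_exch] at h1
  have hxd : ∀ t ∈ Icc 0 g.T, HasDerivWithinAt x (g.redField (N : ℝ)⁻¹ (x t)) (Icc 0 g.T) t := by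
    intro t ht
    have h1 := hasDerivWithinAt_quadOf hN3 (hP.deriv ⟨0, by omega⟩ t ht)
    rwa [(hPx t ht).1, ← g.exch_redField hQ hR hN3 (hPx t ht).2, quadOf_exch] at h1
  have hxT : x g.T = g.redTerminal (N : ℝ)⁻¹ := by
    simp only [hx, hP.terminal]
    rw [← g.exch_redTerminal hQf, quadOf_exch]
  let pr : Quad n → Matrix (Fin n) (Fin n) ℝ × Matrix (Fin n) (Fin n) ℝ := fun y => (y.1, y.2.1)
  have hpr : ∀ a b : Quad n, dist (pr a) (pr b) ≤ dist a b := fun a b => by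
    simp only [pr, Prod.dist_eq]
    exact max_le_max le_rfl (le_max_left _ _)
  -- The missing components are borrowed from x itself, so a lifted point is as close to (0, x t) as
  -- y is to the first two components. They do not affect the limit field, which ignores them.
  let lift : ℝ → Matrix (Fin n) (Fin n) ℝ × Matrix (Fin n) (Fin n) ℝ → ℝ × Quad n :=
    fun t y => (0, y.1, y.2, (x t).2.2)
  have hlift : ∀ t y y', dist (lift t y) (lift t y') = dist y y' := fun t y y' => by
    simp [lift, Prod.dist_eq]
  have hliftmem : ∀ t, ∀ y ∈ closedBall (pr (x t)) δ, lift t y ∈ closedBall ((0 : ℝ), x t) δ := by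
    intro t y hy
    rw [mem_closedBall] at hy ⊢
    exact (hlift t y (pr (x t))).trans_le hy
  let v : Matrix (Fin n) (Fin n) ℝ × Matrix (Fin n) (Fin n) ℝ →
      Matrix (Fin n) (Fin n) ℝ × Matrix (Fin n) (Fin n) ℝ :=
    fun y => (symPart (g.Ψ₁ y.1), g.Ψ₂ y.1 y.2)
  have hv : ∀ t y, v y = pr (g.redField (lift t y).1 (lift t y).2) := fun t y => by
    simp only [v, pr, lift, redField_zero_fst, redField_zero_snd]
  obtain ⟨y, hyT, hy, hyx⟩ := hshadow (fun _ => v) (fun t => pr (x t))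
    (fun t => pr (g.redField (N : ℝ)⁻¹ (x t))) (pr (g.redTerminal 0))
    (fun t ht => (hxd t ht).fst.prodMk (hxd t ht).snd.fst)
    (fun t ht => LipschitzOnWith.of_dist_le_mul fun a ha b hb => by
      rw [hv t a, hv t b, ← hlift t a b]
      exact (hpr _ _).trans ((hK _ (hxs t ht)).1.dist_le_mul _ (hliftmem t a ha) _
        (hliftmem t b hb)))
    (by
      rintro ⟨t, y⟩ ⟨ht, hy⟩
      have hq := (hK _ (hxs t ht)).2 _ (hliftmem t y hy)
      have h1 := (g.contDiffAt_redField hq.isUnit_R hq.isUnit_I).continuousAt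
      have h2 : ContinuousAt (fun p : ℝ × (Matrix (Fin n) (Fin n) ℝ × Matrix (Fin n) (Fin n) ℝ) =>
          lift t p.2) (t, y) := by
        simp only [lift]
        fun_prop
      have h3 : ContinuousAt (fun q : ℝ × Quad n => pr (g.redField q.1 q.2)) (lift t y) :=
        h1.fst.prodMk h1.snd.fst
      have h4 := ContinuousAt.comp (g := fun q : ℝ × Quad n => pr (g.redField q.1 q.2))
        (f := fun p : ℝ × (Matrix (Fin n) (Fin n) ℝ × Matrix (Fin n) (Fin n) ℝ) => lift t p.2)
        (x := (t, y)) h3 h2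
      refine ContinuousAt.continuousWithinAt (h4.congr (.of_forall fun p => ?_))
      exact (hv t p.2).symm)
    -- The defect compares the fields at h = 1/N and h = 0 at the same state, so the Lipschitz bound
    -- in h makes it at most K / N.
    (fun t ht => by
      rw [hv t (pr (x t)), ← dist_eq_norm]
      refine (hpr _ _).trans (le_trans ?_ hNε)
      have h1 := (hK _ (hxs t ht)).1.dist_le_mul ((N : ℝ)⁻¹, x t)
        (by simpa [Prod.dist_eq, hδ.le] using hNδ) (0, x t) (mem_closedBall_self hδ.le)
      simpa [Prod.dist_eq] using h1)
    (by
      rw [hxT, ← dist_eq_norm]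
      exact (hpr _ _).trans hNT)
  rw [redTerminal_zero] at hyT
  have hsymm : ∀ t ∈ Icc 0 g.T, (y t).1.IsSymm :=
    isSymm_of_hasDerivWithinAt (fun t ht => (hy t ht).fst) (fun t _ => symPart_isSymm _)
      (by rw [hyT]; exact hQf)
  refine ⟨fun t => (y t).1, fun t => (y t).2, hsymm, fun t ht => ?_, by rw [hyT], fun t ht => ?_,
    fun t ht => (hy t ht).snd, by rw [hyT]⟩
  · have h1 := (hy t ht).fst
    simp only [v] at h1
    rwa [symPart_of_isSymm (g.Ψ₁_isSymm hQ hR (hsymm t ht))] at h1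
  -- Positivity of `R₁` holds throughout the δ-neighbourhood of s, where the shadowing solution
  -- remains.
  · refine (((hK _ (hxs t ht)).2 _ (hliftmem t _ (hyx t ht))).posSemidef_R
      ?_).posDef_of_sub_smul_one hc
    simp only [lift, IsSymm, R₁, transpose_add, transpose_mul, transpose_transpose,
      (hsymm t ht).eq, hR.eq, Matrix.mul_assoc]

end LQGame

/-! ### Sufficiency: from the limit system to asymptotic solvability -/

namespace LQGame

open Filter Topology Metric
open scoped Matrix.Norms.Frobenius

variable {n m : ℕ} (g : LQGame n m)

/-- In the limit `h = 0` the last two components of the reduced vector field are affine in the last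
two components of the state. -/
theorem redField_zero_smul (a b c d : Matrix (Fin n) (Fin n) ℝ) (r : ℝ) :
    (g.redField 0 (a, b, r • c, r • d)).2.2 =
      r • (g.redField 0 (a, b, c, d)).2.2 + (1 - r) • (g.redField 0 (a, b, 0, 0)).2.2 := by
  -- At h = 0 neither `redM`, `redU` nor `redW` depends on c and d, and the terms quadratic in
  -- `redS` carry a factor h²; what survives is affine through c, d, `redS` and `redX`.
  have hM : ∀ c d, g.redM 0 (a, b, c, d) = g.redM 0 (a, b, 0, 0) := fun c d => by
    simp [redM, redI]
  have hU : ∀ c d, g.redU 0 (a, b, c, d) = g.redU 0 (a, b, 0, 0) := fun c d => by simp [redU]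
  have hW : ∀ c d, g.redW 0 (a, b, c, d) = g.redW 0 (a, b, 0, 0) := fun c d => by simp [redW]
  have hC : g.redPhiCommon 0 (a, b, r • c, r • d) = r • g.redPhiCommon 0 (a, b, c, d) +
      (1 - r) • g.redPhiCommon 0 (a, b, 0, 0) := by
    simp only [redPhiCommon, hM c d, hM (r • c) (r • d), redS]
    simp [Matrix.mul_add, Matrix.add_mul]
    module
  have h₃ : g.redPhi₃ 0 (a, b, r • c, r • d) = r • g.redPhi₃ 0 (a, b, c, d) +
      (1 - r) • g.redPhi₃ 0 (a, b, 0, 0) := by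
    simp only [redPhi₃, hC, hU c d, hU (r • c) (r • d), hW c d, hW (r • c) (r • d), redX]
    simp
    module
  have h₄ : g.redPhi₄ 0 (a, b, r • c, r • d) = r • g.redPhi₄ 0 (a, b, c, d) +
      (1 - r) • g.redPhi₄ 0 (a, b, 0, 0) := by
    simp only [redPhi₄, hC, hU c d, hU (r • c) (r • d), hW c d, hW (r • c) (r • d), redX]
    simp
    module
  simp only [redField, h₃, h₄, symPart, transpose_add, transpose_smul, Prod.smul_mk,
    Prod.mk_add_mk, Prod.mk.injEq]
  constructor <;> module

/-- At `h = 0` the last two components of the reduced vector field are globally Lipschitz in the last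
two components of the state. -/
theorem lipschitzWith_redField_zero {δ : ℝ} (hδ : 0 < δ) {K : NNReal}
    {a b : Matrix (Fin n) (Fin n) ℝ}
    (hK : LipschitzOnWith K (fun q : ℝ × Quad n => g.redField q.1 q.2)
      (closedBall (0, (a, b, 0, 0)) δ)) :
    LipschitzWith K (fun y => (g.redField 0 (a, b, y)).2.2) := by
  have hdist : ∀ y y' : Matrix (Fin n) (Fin n) ℝ × Matrix (Fin n) (Fin n) ℝ,
      dist ((0 : ℝ), ((a, b, y) : Quad n)) (0, (a, b, y')) = dist y y' := fun y y' => by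
    rw [Prod.dist_eq, Prod.dist_eq, Prod.dist_eq, dist_self, dist_self, dist_self,
      max_eq_right dist_nonneg, max_eq_right dist_nonneg, max_eq_right dist_nonneg]
  have hball : ∀ y y' : Matrix (Fin n) (Fin n) ℝ × Matrix (Fin n) (Fin n) ℝ, ‖y‖ ≤ δ → ‖y'‖ ≤ δ →
      dist (g.redField 0 (a, b, y)).2.2 (g.redField 0 (a, b, y')).2.2 ≤ K * dist y y' := by
    intro y y' hy hy'
    have hmem : ∀ w : Matrix (Fin n) (Fin n) ℝ × Matrix (Fin n) (Fin n) ℝ, ‖w‖ ≤ δ →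
        ((0 : ℝ), ((a, b, w) : Quad n)) ∈ closedBall ((0 : ℝ), ((a, b, 0, 0) : Quad n)) δ := by
      intro w hw
      rw [mem_closedBall]
      refine (hdist w 0).trans_le ?_
      rwa [dist_zero_right]
    have h1 := hK.dist_le_mul _ (hmem y hy) _ (hmem y' hy')
    rw [hdist] at h1
    exact ((le_max_right _ _).trans (le_max_right _ _)).trans h1
  refine LipschitzWith.of_dist_le_mul fun y y' => ?_
  have hpos : 0 < max ‖y‖ ‖y'‖ + 1 := by positivity
  -- The factor r shrinks both points into the δ-ball; for an affine map a Lipschitz bound there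
  -- scales back with the same constant.
  set r := δ / (max ‖y‖ ‖y'‖ + 1) with hr
  have hr0 : 0 < r := div_pos hδ hpos
  have hmem : ∀ w : Matrix (Fin n) (Fin n) ℝ × Matrix (Fin n) (Fin n) ℝ,
      ‖w‖ ≤ max ‖y‖ ‖y'‖ → ‖r • w‖ ≤ δ := by
    intro w hw
    rw [norm_smul, Real.norm_of_nonneg hr0.le, hr, div_mul_eq_mul_div, div_le_iff₀ hpos]
    exact mul_le_mul_of_nonneg_left (by linarith) hδ.le
  have hsmul : ∀ w : Matrix (Fin n) (Fin n) ℝ × Matrix (Fin n) (Fin n) ℝ,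
      (g.redField 0 (a, b, r • w)).2.2 =
        r • (g.redField 0 (a, b, w)).2.2 + (1 - r) • (g.redField 0 (a, b, 0, 0)).2.2 := fun w =>
    g.redField_zero_smul a b w.1 w.2 r
  have h1 := hball _ _ (hmem y (le_max_left _ _)) (hmem y' (le_max_right _ _))
  rw [hsmul, hsmul, dist_add_right, dist_smul₀, dist_smul₀, Real.norm_of_nonneg hr0.le,
    mul_left_comm] at h1
  exact le_of_mul_le_mul_left h1 hr0

variable {g} in
/-- The solution of the limit system extends to a solution of the reduced system at `h = 0`. -/
theorem IsLimitSolution.exists_extension {L₁ L₂ : ℝ → Matrix (Fin n) (Fin n) ℝ}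
    (h : g.IsLimitSolution L₁ L₂) (hT : 0 < g.T) (hQ : g.Q.IsSymm) (hR : g.R.IsSymm) :
    ∃ z : ℝ → Quad n, z g.T = g.redTerminal 0 ∧ (∀ t, (z t).1 = L₁ t) ∧
      ∀ t ∈ Icc 0 g.T, HasDerivWithinAt z (g.redField 0 (z t)) (Icc 0 g.T) t := by
  have hc₁ : ContinuousOn L₁ (Icc 0 g.T) := fun t ht => (h.deriv₁ t ht).continuousWithinAt
  have hc₂ : ContinuousOn L₂ (Icc 0 g.T) := fun t ht => (h.deriv₂ t ht).continuousWithinAt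
  -- Zeros in the last two slots suffice: by affinity, the Lipschitz constant near zero is a global
  -- one.
  have hs : IsCompact ((fun t => ((L₁ t, L₂ t, 0, 0) : Quad n)) '' Icc 0 g.T) :=
    isCompact_Icc.image_of_continuousOn (by fun_prop)
  obtain ⟨δ, hδ, c, -, K, hK⟩ := g.exists_uniform_neighbourhood hs (by
    rintro _ ⟨t, ht, rfl⟩
    exact h.posDef t ht)
  have hlip : ∀ t ∈ Icc 0 g.T,
      LipschitzWith K (fun y => (g.redField 0 (L₁ t, L₂ t, y)).2.2) := fun t ht =>
    g.lipschitzWith_redField_zero hδ (hK _ (mem_image_of_mem _ ht)).1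
  have hcont : ContinuousOn (fun p : ℝ × (Matrix (Fin n) (Fin n) ℝ × Matrix (Fin n) (Fin n) ℝ) =>
      (g.redField 0 (L₁ p.1, L₂ p.1, p.2)).2.2) (Icc 0 g.T ×ˢ univ) := by
    have h1 : ContinuousOn (fun p : ℝ × (Matrix (Fin n) (Fin n) ℝ × Matrix (Fin n) (Fin n) ℝ) =>
        ((0, (L₁ p.1, L₂ p.1, p.2)) : ℝ × Quad n)) (Icc 0 g.T ×ˢ univ) :=
      continuousOn_const.prodMk ((hc₁.comp continuousOn_fst fun p hp => hp.1).prodMk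
        ((hc₂.comp continuousOn_fst fun p hp => hp.1).prodMk continuousOn_snd))
    intro p hp
    have h2 : ContinuousAt (fun q : ℝ × Quad n => (g.redField q.1 q.2).2.2)
        (0, (L₁ p.1, L₂ p.1, p.2)) :=
      (g.contDiffAt_redField (p := (0, (L₁ p.1, L₂ p.1, p.2))) (h.posDef p.1 hp.1).isUnit
        (by simp [redI])).continuousAt.snd.snd
    exact ContinuousAt.comp_continuousWithinAt
      (g := fun q : ℝ × Quad n => (g.redField q.1 q.2).2.2)
      (f := fun p : ℝ × (Matrix (Fin n) (Fin n) ℝ × Matrix (Fin n) (Fin n) ℝ) =>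
        ((0, (L₁ p.1, L₂ p.1, p.2)) : ℝ × Quad n)) h2 (h1 p hp)
  obtain ⟨y, hyT, hy⟩ := exists_terminal_solution_of_lipschitzWith
    (v := fun t y => (g.redField 0 (L₁ t, L₂ t, y)).2.2) hT hlip hcont
    (g.Γfᵀ * g.Qf * g.Γf, g.Γfᵀ * g.Qf * g.Γf)
  have hfield : ∀ t ∈ Icc 0 g.T, g.redField 0 (L₁ t, L₂ t, y t) =
      (g.Ψ₁ (L₁ t), g.Ψ₂ (L₁ t) (L₂ t), (g.redField 0 (L₁ t, L₂ t, y t)).2.2) := by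
    intro t ht
    refine Prod.ext ?_ (Prod.ext ?_ rfl)
    · rw [redField_zero_fst, symPart_of_isSymm (g.Ψ₁_isSymm hQ hR (h.symm t ht))]
    · rw [redField_zero_snd]
  refine ⟨fun t => (L₁ t, L₂ t, y t), ?_, fun t => rfl, fun t ht => ?_⟩
  · simp only [hyT, h.terminal₁, h.terminal₂, redTerminal_zero]
  · rw [hfield t ht]
    exact (h.deriv₁ t ht).prodMk ((h.deriv₂ t ht).prodMk (hy t ht))

variable {g} in
theorem IsLimitSolution.asymptoticallySolvable {L₁ L₂ : ℝ → Matrix (Fin n) (Fin n) ℝ}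
    (h : g.IsLimitSolution L₁ L₂) (hT : 0 < g.T) (hQ : g.Q.IsSymm) (hQf : g.Qf.IsSymm)
    (hR : g.R.IsSymm) : g.AsymptoticallySolvable := by
  obtain ⟨z, hzT, hz₁, hz⟩ := h.exists_extension hT hQ hR
  have hzc : ContinuousOn z (Icc 0 g.T) := fun t ht => (hz t ht).continuousWithinAt
  obtain ⟨δ, hδ, c, hc, K, hK⟩ := g.exists_uniform_neighbourhood
    (isCompact_Icc.image_of_continuousOn hzc) (by
      rintro _ ⟨t, ht, rfl⟩
      rw [hz₁]
      exact h.posDef t ht)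
  replace hK := fun t ht => hK (z t) (mem_image_of_mem z ht)
  obtain ⟨C, hC⟩ := isCompact_Icc.exists_bound_of_continuousOn hzc
  obtain ⟨ε, hε, hshadow⟩ := exists_terminal_solution_near_approximate_solution (E := Quad n)
    g.T hT K hδ
  have hinv : Tendsto (fun N : ℕ => (N : ℝ)⁻¹) atTop (𝓝 0) := tendsto_inv_atTop_nhds_zero_nat
  have hterm : Tendsto (fun N : ℕ => dist (g.redTerminal 0) (g.redTerminal (N : ℝ)⁻¹)) atTop
      (𝓝 0) := by
    have h1 := (tendsto_const_nhds (x := g.redTerminal 0)).dist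
      ((g.continuous_redTerminal.tendsto 0).comp hinv)
    rwa [dist_self] at h1
  have hKinv : Tendsto (fun N : ℕ => (K : ℝ) * (N : ℝ)⁻¹) atTop (𝓝 0) := by
    simpa using hinv.const_mul (K : ℝ)
  obtain ⟨N₀, hN₀⟩ := eventually_atTop.1 ((hinv.eventually_le_const hδ).and
    ((hKinv.eventually_le_const hε).and (hterm.eventually_le_const hε)))
  -- The neighbourhood constant c serves as c₀. The shadowing solution has sup norm at most C + δ,
  -- and the rescaled size adds four components.
  refine ⟨max 3 N₀, le_max_left _ _, c, hc, 4 * (C + δ), fun N hN => ?_⟩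
  obtain ⟨hNδ, hNε, hNT⟩ := hN₀ N ((le_max_right _ _).trans hN)
  have hN3 : 3 ≤ N := (le_max_left _ _).trans hN
  have hmem : ∀ t, ∀ y ∈ closedBall (z t) δ, ((N : ℝ)⁻¹, y) ∈ closedBall ((0 : ℝ), z t) δ := by
    intro t y hy
    rw [mem_closedBall] at hy
    rw [mem_closedBall, Prod.dist_eq]
    exact max_le (by simpa using hNδ) hy
  have hlip : ∀ t ∈ Icc 0 g.T,
      LipschitzOnWith K (g.redField (N : ℝ)⁻¹) (closedBall (z t) δ) := fun t ht =>
    LipschitzOnWith.of_dist_le_mul fun a ha b hb => by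
      have h1 := (hK t ht).1.dist_le_mul _ (hmem t a ha) _ (hmem t b hb)
      have h2 : dist ((N : ℝ)⁻¹, a) ((N : ℝ)⁻¹, b) = dist a b := by
        rw [Prod.dist_eq, dist_self, max_eq_right dist_nonneg]
      rwa [h2] at h1
  have hcont : ∀ t ∈ Icc 0 g.T, ∀ y ∈ closedBall (z t) δ,
      ContinuousAt (g.redField (N : ℝ)⁻¹) y := by
    intro t ht y hy
    have hq := (hK t ht).2 _ (hmem t y hy)
    have h1 := (g.contDiffAt_redField hq.isUnit_R hq.isUnit_I).continuousAt
    exact ContinuousAt.comp (g := fun q : ℝ × Quad n => g.redField q.1 q.2)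
      (f := fun y : Quad n => ((N : ℝ)⁻¹, y)) h1 (by fun_prop)
  have happrox : ∀ t ∈ Icc 0 g.T,
      ‖g.redField 0 (z t) - g.redField (N : ℝ)⁻¹ (z t)‖ ≤ ε := fun t ht => by
    have h1 := (hK t ht).1.dist_le_mul (0, z t) (mem_closedBall_self hδ.le) _
      (hmem t (z t) (mem_closedBall_self hδ.le))
    rw [← dist_eq_norm]
    have h2 : dist ((0 : ℝ), z t) ((N : ℝ)⁻¹, z t) = (N : ℝ)⁻¹ := by
      rw [Prod.dist_eq, dist_self, max_eq_left dist_nonneg, Real.dist_eq, zero_sub, abs_neg,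
        abs_of_nonneg (by positivity)]
    rw [h2] at h1
    exact h1.trans hNε
  have hT' : ‖z g.T - g.redTerminal (N : ℝ)⁻¹‖ ≤ ε := by
    rw [hzT, ← dist_eq_norm]
    exact hNT
  obtain ⟨y, hyT, hy, hyz⟩ := hshadow (fun _ => g.redField (N : ℝ)⁻¹) z
    (fun t => g.redField 0 (z t)) (g.redTerminal (N : ℝ)⁻¹) hz hlip
    (fun p hp => ((hcont p.1 hp.1 p.2 hp.2).comp continuousAt_snd).continuousWithinAt) happrox hT'
  obtain ⟨hsol, hbR⟩ := g.isRiccatiSolution_exch hQ hQf hR hN3 hc hyT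
    (fun t ht => (hy t ht).fst) (fun t ht => (hy t ht).snd.fst)
    (fun t ht => (hy t ht).snd.snd.fst) (fun t ht => (hy t ht).snd.snd.snd)
    (fun t ht => (hK t ht).2 _ (hmem t _ (hyz t ht)))
  refine ⟨fun i t => exch (y t) i, hsol, fun t ht => ?_, hbR, hsol.isUnit⟩
  refine (rescaledSize_exch_le hN3 (y t)).trans ?_
  have h1 : ‖y t‖ ≤ ‖z t‖ + ‖y t - z t‖ := norm_le_norm_add_norm_sub' _ _
  have h2 : ‖y t - z t‖ ≤ δ := by
    rw [← dist_eq_norm]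
    exact hyz t ht
  linarith [hC t ht]

end LQGame

/-- The LQ Nash game with controlled individual and common noise and symmetric, possibly indefinite,
weights is asymptotically solvable if and only if the low-dimensional Riccati system has a solution
`(Λ₁, Λ₂)` on `[0, T]`. -/
theorem mainTheorem1 {n m : ℕ} (g : LQGame n m) (hT : 0 < g.T)
    (hQ : g.Q.IsSymm) (hQf : g.Qf.IsSymm) (hR : g.R.IsSymm) :
    g.AsymptoticallySolvable ↔
      ∃ L₁ L₂ : ℝ → Matrix (Fin n) (Fin n) ℝ, g.IsLimitSolution L₁ L₂ :=
  ⟨fun h => h.exists_isLimitSolution hT hQ hQf hR,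
    fun ⟨_, _, h⟩ => h.asymptoticallySolvable hT hQ hQf hR⟩
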